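/- Let $p<0$, $q\in\mathbb R$, $b(x)=\tfrac14x^4+\tfrac12px^2+qx$, and let $\Omega=\{(z_1,z_2)\in\mathbb C^2:\ \operatorname{Im}z_2>b(\operatorname{Re}z_1)\}$. Identify $\partial\Omega$ with $\mathbb R^3$ through $(x,y,t)\mapsto(x+iy,\,t+ib(x))$ and give it the measure $d\sigma=dx\,dy\,dt$. Let $\mathcal H^2(\Omega)$ be the space of holomorphic functions $F$ on $\Omega$ with $\sup_{\varepsilon>0}\int_{\mathbb R^3}|F(x+iy,t+ib(x)+i\varepsilon)|^2\,dx\,dy\,dt<\infty$; on $\partial\Omega$ such an $F$ stands for its boundary value, the limit in $L^2(\mathbb R^3)$ of $F(x+iy,t+ib(x)+i\varepsilon)$ as $\varepsilon\to0^+$. The Szegő kernel of $\Omega$ is the function $S$ on $\Omega\times\Omega$ such that, for every $z\in\Omega$, $\overline{S(z,\cdot)}\in\mathcal H^2(\Omega)$ and $g(z)=\int_{\partial\Omega}S(z,w)g(w)\,d\sigma(w)$ for all $g\in\mathcal H^2(\Omega)$. Call $S$ non-singular at $(z,w)\in\partial\Omega\times\partial\Omega$ if it agrees on $\Omega\times\Omega$,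 near $(z,w)$, with a $C^\infty$ function defined on a neighbourhood of $(z,w)$ in $\mathbb C^2\times\mathbb C^2$, and singular otherwise. Then $\Omega$ is not (Levi) pseudoconvex, and its Szegő kernel $S$ exists (that is, all the boundary values and the kernel above exist), is unique on $\Omega\times\Omega$, and has the following properties. 1. $S$ is non-singular at the point $(z,z)$ of the boundary diagonal for every $z\in\partial\Omega$ with $|\operatorname{Re}z_1|<\sqrt{-p}$. 2. For $a=\pm\sqrt{-p}$ and all $y,t\in\mathbb R$, the points $z=(a+iy,\,t+ib(a))$ and $w=(-a+iy,\,t+ib(-a))$ are distinct points of $\partial\Omega$, and $S$ is singular at $(z,w)$; moreover $\operatorname{Re}S\big((a+iy,\,t+i(b(a)+h)),\,(-a+iy,\,t+i(b(-a)+k))\big)\to+\infty$ as $(h,k)\to(0,0)$ with $h,k>0$. In particular, for a non-pseudoconvex domain the Szegő kernel may be non-singular at some points of the boundary diagonal and singular at some points off the diagonal. -/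

import Mathlib

open MeasureTheory Filter Topology
open scoped ContDiff

noncomputable section

/-- The quartic `b(x) = x⁴/4 + p x²/2 + q x`. -/
def quartic (p q : ℝ) (x : ℝ) : ℝ := x ^ 4 / 4 + p * x ^ 2 / 2 + q * x

/-- The tube domain `{(z₁, z₂) : Im z₂ > b (Re z₁)}` in `ℂ²`. -/
def tubeDomain (b : ℝ → ℝ) : Set (ℂ × ℂ) := {z | b z.1.re < z.2.im}

/-- The point `(x + i y, t + i (b x + h))`; for `h = 0` it lies on the boundary of the tube domain,
and `(x, y, t)` are the usual coordinates of that boundary. -/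
def tubePoint (b : ℝ → ℝ) (x y t h : ℝ) : ℂ × ℂ := (⟨x, y⟩, ⟨t, b x + h⟩)

/-! ### Pseudoconvexity of domains with smooth boundary -/

/-- `ρ` is a `C²` defining function of `Ω` near `z`. -/
def IsLocalDefiningFunction (Ω : Set (ℂ × ℂ)) (z : ℂ × ℂ) (ρ : ℂ × ℂ → ℝ) : Prop :=
  ∃ U : Set (ℂ × ℂ), IsOpen U ∧ z ∈ U ∧ ContDiffOn ℝ 2 ρ U ∧
    Ω ∩ U = {w | ρ w < 0} ∩ U ∧ fderiv ℝ ρ z ≠ 0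

/-- The Levi form `∑ ρ_{z_j \bar z_k} v_j \bar v_k` at `z`, written through the real Hessian
as `(D²ρ(v, v) + D²ρ(iv, iv)) / 4`. -/
def leviForm (ρ : ℂ × ℂ → ℝ) (z v : ℂ × ℂ) : ℝ :=
  (fderiv ℝ (fderiv ℝ ρ) z v v +
    fderiv ℝ (fderiv ℝ ρ) z (Complex.I • v) (Complex.I • v)) / 4

/-- Levi pseudoconvexity of an open set with `C²` boundary: at each boundary point the Levi form
of a defining function is nonnegative on the complex tangent space. The two equations say that
`v` is complex tangential, that is `∑ ρ_{z_j} v_j = 0`. -/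
def IsPseudoconvex (Ω : Set (ℂ × ℂ)) : Prop :=
  ∀ z ∈ frontier Ω, ∀ ρ : ℂ × ℂ → ℝ, IsLocalDefiningFunction Ω z ρ →
    ∀ v : ℂ × ℂ, fderiv ℝ ρ z v = 0 → fderiv ℝ ρ z (Complex.I • v) = 0 → 0 ≤ leviForm ρ z v

/-! ### The Hardy space and the Szegő kernel of a tube domain -/

/-- The restriction of `F` to the translated boundary `{Im z₂ = b (Re z₁) + ε}`, as a function of
`(x, y, t)`. -/
def slice (b : ℝ → ℝ) (F : ℂ × ℂ → ℂ) (ε : ℝ) : ℝ × ℝ × ℝ → ℂ :=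
  fun u => F (tubePoint b u.1 u.2.1 u.2.2 ε)

/-- `F` belongs to the Hardy space `H²` of the tube domain: it is holomorphic there and
`sup_{ε > 0} ∫ |F(x + iy, t + i b(x) + i ε)|² dx dy dt < ∞`. -/
def MemHardy (b : ℝ → ℝ) (F : ℂ × ℂ → ℂ) : Prop :=
  DifferentiableOn ℂ F (tubeDomain b) ∧
    (⨆ ε : ℝ, ⨆ _ : 0 < ε, ∫⁻ u : ℝ × ℝ × ℝ, ‖slice b F ε u‖ₑ ^ 2) < (⊤ : ENNReal)

/-- `f` is the boundary value of `F`: the slices of `F` converge to `f` in `L²(dx dy dt)`. -/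
def IsBoundaryValue (b : ℝ → ℝ) (F : ℂ × ℂ → ℂ) (f : ℝ × ℝ × ℝ → ℂ) : Prop :=
  MemLp f 2 volume ∧
    Tendsto (fun ε : ℝ => eLpNorm (slice b F ε - f) 2 volume) (𝓝[>] 0) (𝓝 0)

/-- `S` is the Szegő kernel of the tube domain, the reproducing kernel of its Hardy space: for `z`
in the domain, `w ↦ conj (S(z, w))` is in `H²`, and each `g` in `H²` satisfies
`g(z) = ∫ S(z, w) g(w) dσ(w)`, the integral over the boundary being formed with the boundary values
(`k` those of `conj (S(z, ·))`, `γ` those of `g`) and with the measure `dσ = dx dy dt`. -/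
def IsSzegoKernel (b : ℝ → ℝ) (S : ℂ × ℂ → ℂ × ℂ → ℂ) : Prop :=
  ∀ z ∈ tubeDomain b,
    MemHardy b (fun w => starRingEnd ℂ (S z w)) ∧
    ∃ k : ℝ × ℝ × ℝ → ℂ, IsBoundaryValue b (fun w => starRingEnd ℂ (S z w)) k ∧
      ∀ g : ℂ × ℂ → ℂ, MemHardy b g →
        ∃ γ : ℝ × ℝ × ℝ → ℂ, IsBoundaryValue b g γ ∧
          g z = ∫ u : ℝ × ℝ × ℝ, starRingEnd ℂ (k u) * γ u

/-- A kernel `S` on `Ω × Ω` is non-singular at `(z₀, w₀)` if it extends to a smooth function on a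
neighbourhood of `(z₀, w₀)`. Only the values of `S` on `Ω × Ω` matter. -/
def IsNonsingularAt (Ω : Set (ℂ × ℂ)) (S : ℂ × ℂ → ℂ × ℂ → ℂ) (z₀ w₀ : ℂ × ℂ) : Prop :=
  ∃ U : Set ((ℂ × ℂ) × (ℂ × ℂ)), IsOpen U ∧ (z₀, w₀) ∈ U ∧
    ∃ G : (ℂ × ℂ) × (ℂ × ℂ) → ℂ, ContDiffOn ℝ ∞ G U ∧
      ∀ z ∈ Ω, ∀ w ∈ Ω, (z, w) ∈ U → G (z, w) = S z w

end

/-!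
The proof identifies the Hardy space of a tube domain `{Im z₂ > b (Re z₁)}` with a weighted `L²`
space of frequencies, writes the Szegő kernel as an explicit integral over the frequencies, and
reads off where that integral converges.

**The Hardy space.** For a frequency `v = η + i τ` the exponential `exp (2π (η z₁ + i τ z₂))` has on
the boundary of the domain the mass `N(v) = ∫ exp (4π (η x - τ b(x))) dx` in the variable `x`. By
Plancherel's theorem in the variables `Im z₁` and `Re z₂`, the Laplace integral
`∫ exp (2π (η z₁ + i τ z₂)) f(v) dv` over `τ > 0` is isometric from `L²(N dv)` to `L²` of the
boundary (`lintegral_slice_laplace`); hence such integrals lie in the Hardy space, have boundary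
values, and the passage to boundary values preserves inner products (`memHardy_laplace`,
`exists_isBoundaryValue_laplace`, `integral_conj_boundaryValue`). Conversely each function in the
Hardy space is such an integral (`exists_eq_laplace`). To see this, multiply the function by
`exp (δ (z₁² - z₂²))`: the product decays like a Gaussian on the fibres `Re z₁ = x`, `Im z₂ = s`, so
by Cauchy's theorem its Fourier–Laplace coefficients do not depend on the fibre
(`HasGaussianBound.integral_fibre_eq`), and this survives the limit `δ → 0` in `L²` of almost every
fibre. For the quartic the weight is infinite for `τ < 0`, which excludes negative frequencies.

**The Szegő kernel.** Point evaluation at `z` is the inner product with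
`conj (exp (2π (η z₁ + i τ z₂))) / N(v)` in `L²(N dv)` (`integral_conj_kernelFun`). Therefore
`S(z, w) = ∫ exp (2π (η (z₁ + conj w₁) + i τ (z₂ - conj w₂))) / N(v) dv`
is the Szegő kernel (`isSzegoKernel_szegoKernel`), and it is unique by the usual symmetry argument
(`IsSzegoKernel.eq`).

**The quartic.** For `p < 0` the line `q x - p²/4` touches the graph of the quartic from below at
`x = ±√(-p)` and nowhere else. Since exponentials are convex, the integral for `S(z, z)` converges
absolutely not only in the domain but at all points with `|Re z₁| < √(-p)` above the bitangent line,
which lie in the convex hull of the domain (`lintegral_quartic_lt_top`). The boundary points with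
`|Re z₁| < √(-p)` are interior points of this set, and absolutely convergent Laplace integrals are
smooth (`contDiffOn_laplace`): this is the regularity on the diagonal. Above the pair of points of
tangency the integrand is positive and equal to `exp (π p² τ - 2π τ (h + k)) / N(v)`, while `N(v)`
is at most a constant times `exp (π p² τ)` on the strip `|η - q τ| ≤ 1`, `τ ≥ 1`
(`exists_weight_quartic_le`); so the integral tends to infinity as `h, k → 0`
(`tendsto_szegoKernel_re`). Finally the quartic is concave at `0`, which makes the Levi form
negative there (`not_isPseudoconvex_quartic`).
-/

open scoped FourierTransform SchwartzMap

noncomputable section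

/-! ### Laplace integrals -/

/-- The complex linear form `z ↦ 2π (η z₁ + i τ z₂)` of the frequency `v = η + i τ`. -/
def freqForm (v : ℂ) : ℂ × ℂ →L[ℂ] ℂ :=
  (2 * Real.pi * v.re : ℂ) • ContinuousLinearMap.fst ℂ ℂ ℂ +
    (2 * Real.pi * v.im * Complex.I : ℂ) • ContinuousLinearMap.snd ℂ ℂ ℂ

lemma freqForm_apply (v : ℂ) (z : ℂ × ℂ) :
    freqForm v z = 2 * Real.pi * v.re * z.1 + 2 * Real.pi * v.im * Complex.I * z.2 := by
  simp [freqForm]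

lemma freqForm_re (v : ℂ) (z : ℂ × ℂ) :
    (freqForm v z).re = 2 * Real.pi * (v.re * z.1.re - v.im * z.2.im) := by
  simp [freqForm_apply]; ring

lemma continuous_freqForm_apply (z : ℂ × ℂ) : Continuous fun v => freqForm v z := by
  simp only [freqForm_apply]
  fun_prop

lemma norm_freqForm_le (v : ℂ) : ‖freqForm v‖ ≤ 2 * Real.pi * (|v.re| + |v.im|) := by
  refine ContinuousLinearMap.opNorm_le_bound _ (by positivity) fun z => ?_
  rw [freqForm_apply]
  have h1 : ‖z.1‖ ≤ ‖z‖ := norm_fst_le z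
  have h2 : ‖z.2‖ ≤ ‖z‖ := norm_snd_le z
  refine (norm_add_le _ _).trans ?_
  simp only [norm_mul, Complex.norm_real, Complex.norm_I, Real.norm_eq_abs, mul_one,
    abs_of_pos Real.pi_pos, RCLike.norm_ofNat]
  have h3 : 2 * Real.pi * |v.re| * ‖z.1‖ ≤ 2 * Real.pi * |v.re| * ‖z‖ := by gcongr
  have h4 : 2 * Real.pi * |v.im| * ‖z.2‖ ≤ 2 * Real.pi * |v.im| * ‖z‖ := by gcongr
  linarith

/-- Values of the exponential of `freqForm v` near `ζ`, even multiplied by the size of the form, are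
controlled by the values at the four corners of a larger box. -/
lemma norm_freqForm_mul_exp_le {r : ℝ} (hr : 0 < r) (v : ℂ) {ζ ξ : ℂ × ℂ} (h : ‖ξ - ζ‖ ≤ r) :
    ‖freqForm v‖ * ‖Complex.exp (freqForm v ξ)‖ ≤ r⁻¹ *
      (‖Complex.exp (freqForm v (ζ + ((2 * r : ℂ), 2 * r * Complex.I)))‖ +
        ‖Complex.exp (freqForm v (ζ + ((2 * r : ℂ), -(2 * r * Complex.I))))‖ +
        ‖Complex.exp (freqForm v (ζ + (-(2 * r : ℂ), 2 * r * Complex.I)))‖ +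
        ‖Complex.exp (freqForm v (ζ + (-(2 * r : ℂ), -(2 * r * Complex.I))))‖) := by
  set A := 2 * Real.pi * (|v.re| + |v.im|) with hA
  have hA0 : 0 ≤ A := by positivity
  have h1 : ‖freqForm v‖ ≤ r⁻¹ * Real.exp (A * r) := by
    refine (norm_freqForm_le v).trans ?_
    rw [← hA, inv_mul_eq_div, le_div_iff₀ hr]
    linarith [Real.add_one_le_exp (A * r)]
  have h2 : ‖Complex.exp (freqForm v ξ)‖ ≤ Real.exp ((freqForm v ζ).re + A * r) := by
    rw [Complex.norm_exp]
    apply Real.exp_le_exp.2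
    have : (freqForm v ξ).re - (freqForm v ζ).re ≤ A * r := by
      rw [← Complex.sub_re, ← map_sub]
      calc _ ≤ ‖freqForm v (ξ - ζ)‖ := Complex.re_le_norm _
        _ ≤ ‖freqForm v‖ * ‖ξ - ζ‖ := ContinuousLinearMap.le_opNorm _ _
        _ ≤ A * r := by gcongr; exact norm_freqForm_le v
    linarith
  have h3 : ∀ x : ℝ, Real.exp |x| ≤ Real.exp x + Real.exp (-x) := fun x => by
    rcases abs_cases x with ⟨h, -⟩ | ⟨h, -⟩ <;> rw [h] <;>
      linarith [Real.exp_pos x, Real.exp_pos (-x)]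
  have e1 := h3 (4 * Real.pi * r * v.re)
  have e2 := h3 (4 * Real.pi * r * v.im)
  have c0 : (0:ℝ) ≤ 4 * Real.pi * r := by positivity
  rw [abs_mul, abs_of_nonneg c0] at e1 e2
  calc ‖freqForm v‖ * ‖Complex.exp (freqForm v ξ)‖
      ≤ (r⁻¹ * Real.exp (A * r)) * Real.exp ((freqForm v ζ).re + A * r) := by gcongr
    _ = r⁻¹ * (Real.exp (freqForm v ζ).re * (Real.exp (4 * Real.pi * r * |v.re|) *
          Real.exp (4 * Real.pi * r * |v.im|))) := by
        rw [mul_assoc, ← Real.exp_add, ← Real.exp_add, ← Real.exp_add]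
        congr 2; rw [hA]; ring
    _ ≤ r⁻¹ * (Real.exp (freqForm v ζ).re * ((Real.exp (4 * Real.pi * r * v.re) +
          Real.exp (-(4 * Real.pi * r * v.re))) * (Real.exp (4 * Real.pi * r * v.im) +
          Real.exp (-(4 * Real.pi * r * v.im))))) := by gcongr
    _ = _ := by
        simp only [Complex.norm_exp, freqForm_re]
        simp only [mul_add, add_mul, ← Real.exp_add]
        simp
        ring_nf

section Laplace

variable {μ : Measure ℂ} {w : ℂ → ℂ} {U : Set (ℂ × ℂ)}

lemma aestronglyMeasurable_of_exp_mul {ζ : ℂ × ℂ}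
    (h : AEStronglyMeasurable (fun v => Complex.exp (freqForm v ζ) * w v) μ) :
    AEStronglyMeasurable w μ := by
  have : w = fun v => Complex.exp (-freqForm v ζ) * (Complex.exp (freqForm v ζ) * w v) := by
    ext v; rw [← mul_assoc, ← Complex.exp_add]; simp
  rw [this]
  exact ((continuous_freqForm_apply ζ).neg.cexp.aestronglyMeasurable).mul h

/-- Differentiation under the integral sign of a Laplace integral that converges absolutely on
an open set. -/
lemma hasFDerivAt_laplace (hU : IsOpen U)
    (h : ∀ ζ ∈ U, Integrable (fun v => Complex.exp (freqForm v ζ) * w v) μ) {ζ : ℂ × ℂ}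
    (hζ : ζ ∈ U) :
    Integrable (fun v => (Complex.exp (freqForm v ζ) * w v) • freqForm v) μ ∧
    HasFDerivAt (fun ξ => ∫ v, Complex.exp (freqForm v ξ) * w v ∂μ)
      (∫ v, (Complex.exp (freqForm v ζ) * w v) • freqForm v ∂μ) ζ := by
  obtain ⟨R, hR, hRU⟩ := Metric.isOpen_iff.1 hU ζ hζ
  set r := R / 4 with hr
  have hr0 : 0 < r := by positivity
  have hmem : ∀ a b : ℂ, ‖a‖ ≤ 2 * r → ‖b‖ ≤ 2 * r → ζ + (a, b) ∈ U := fun a b ha hb => by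
    apply hRU
    rw [Metric.mem_ball, dist_eq_norm, add_sub_cancel_left]
    refine lt_of_le_of_lt (max_le ha hb) ?_
    rw [hr]; linarith
  have hw : AEStronglyMeasurable w μ := aestronglyMeasurable_of_exp_mul (h ζ hζ).1
  have n1 : ‖(2 * r : ℂ)‖ ≤ 2 * r := by
    simp [abs_of_pos hr0]
  have n2 : ‖(2 * r * Complex.I : ℂ)‖ ≤ 2 * r := by simp [abs_of_pos hr0]
  have n1' : ‖-(2 * r : ℂ)‖ ≤ 2 * r := by rwa [norm_neg]
  have n2' : ‖-(2 * r * Complex.I : ℂ)‖ ≤ 2 * r := by rwa [norm_neg]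
  let bd : ℂ → ℝ := fun v => r⁻¹ *
      (‖Complex.exp (freqForm v (ζ + ((2 * r : ℂ), 2 * r * Complex.I))) * w v‖ +
        ‖Complex.exp (freqForm v (ζ + ((2 * r : ℂ), -(2 * r * Complex.I)))) * w v‖ +
        ‖Complex.exp (freqForm v (ζ + (-(2 * r : ℂ), 2 * r * Complex.I))) * w v‖ +
        ‖Complex.exp (freqForm v (ζ + (-(2 * r : ℂ), -(2 * r * Complex.I)))) * w v‖)
  have hbd : Integrable bd μ := by
    refine Integrable.const_mul ?_ _
    exact (((h _ (hmem _ _ n1 n2)).norm.add (h _ (hmem _ _ n1 n2')).norm).add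
      (h _ (hmem _ _ n1' n2)).norm).add (h _ (hmem _ _ n1' n2')).norm
  have hle : ∀ v, ∀ ξ ∈ Metric.ball ζ r,
      ‖(Complex.exp (freqForm v ξ) * w v) • freqForm v‖ ≤ bd v := fun v ξ hξ => by
    have := norm_freqForm_mul_exp_le hr0 v (mem_ball_iff_norm.1 hξ).le
    calc _ = (‖freqForm v‖ * ‖Complex.exp (freqForm v ξ)‖) * ‖w v‖ := by
          rw [norm_smul, norm_mul]; ring
      _ ≤ _ := by
          refine (mul_le_mul_of_nonneg_right this (norm_nonneg _)).trans (le_of_eq ?_)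
          simp only [bd, norm_mul]; ring
  have hcont : Continuous freqForm := by
    unfold freqForm
    fun_prop
  have hm : AEStronglyMeasurable (fun v => (Complex.exp (freqForm v ζ) * w v) • freqForm v) μ :=
    ((continuous_freqForm_apply ζ).cexp.aestronglyMeasurable.mul hw).smul
      hcont.aestronglyMeasurable
  refine ⟨hbd.mono' hm (ae_of_all _ fun v => hle v ζ (Metric.mem_ball_self hr0)), ?_⟩
  refine hasFDerivAt_integral_of_dominated_of_fderiv_le (Metric.ball_mem_nhds ζ hr0)
    (Eventually.of_forall fun ξ =>
      (continuous_freqForm_apply ξ).cexp.aestronglyMeasurable.mul hw) (h ζ hζ)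
    (F' := fun ξ v => (Complex.exp (freqForm v ξ) * w v) • freqForm v)
    hm (ae_of_all _ hle) hbd (ae_of_all _ fun v ξ _ => ?_)
  have := ((freqForm v).hasFDerivAt (x := ξ)).cexp.mul_const (w v)
  rw [smul_smul, mul_comm] at this
  exact this

/-- An absolutely convergent Laplace integral is smooth. -/
theorem contDiffOn_laplace (hU : IsOpen U)
    (h : ∀ ζ ∈ U, Integrable (fun v => Complex.exp (freqForm v ζ) * w v) μ) :
    ContDiffOn ℂ ∞ (fun ξ => ∫ v, Complex.exp (freqForm v ξ) * w v ∂μ) U := by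
  rw [contDiffOn_infty]
  intro n
  induction n generalizing w with
  | zero =>
    refine contDiffOn_zero.2 fun ζ hζ => ?_
    exact (hasFDerivAt_laplace hU h hζ).2.continuousAt.continuousWithinAt
  | succ n ih =>
    rw [Nat.cast_succ]
    refine contDiffOn_succ_of_fderiv_apply
      (fun ζ hζ => (hasFDerivAt_laplace hU h hζ).2.differentiableAt.differentiableWithinAt)
      (fun hn => absurd hn (by simp)) fun y => ?_
    have h' : ∀ ζ ∈ U, Integrable (fun v => Complex.exp (freqForm v ζ) *
        (w v * freqForm v y)) μ := fun ζ hζ => by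
      have := (hasFDerivAt_laplace hU h hζ).1.apply_continuousLinearMap y
      exact this.congr (ae_of_all _ fun v => mul_assoc _ _ _)
    refine (ih h').congr fun ζ hζ => ?_
    rw [fderivWithin_of_isOpen hU hζ, (hasFDerivAt_laplace hU h hζ).2.fderiv,
      ContinuousLinearMap.integral_apply (hasFDerivAt_laplace hU h hζ).1]
    exact integral_congr_ae (ae_of_all _ fun v => mul_assoc _ _ _)

end Laplace

/-! ### The Fourier transform on `L¹ ∩ L²` -/

section
variable {V : Type*} [NormedAddCommGroup V] [InnerProductSpace ℝ V] [FiniteDimensional ℝ V]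
  [MeasurableSpace V] [BorelSpace V]

/-- On `L¹ ∩ L²` the inverse Fourier transform of `L²` is given by the Fourier integral. -/
lemma coeFn_fourierInv_toLp {h : V → ℂ} (h1 : Integrable h) (h2 : MemLp h 2) :
    (𝓕⁻ (h2.toLp h) : Lp ℂ 2 (volume : Measure V)) =ᵐ[volume] 𝓕⁻ h := by
  have hc : Continuous (𝓕⁻ h) := by
    rw [Real.fourierInv_eq_fourier_comp_neg]
    exact VectorFourier.fourierIntegral_continuous Real.continuous_fourierChar
      (innerSL ℝ).continuous₂ h1.comp_neg
  refine ae_eq_of_integral_contDiff_smul_eq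
    ((Lp.memLp _).locallyIntegrable (by norm_num)) hc.locallyIntegrable fun φ φs φc => ?_
  have hg₁ : HasCompactSupport (Complex.ofRealCLM ∘ φ) := φc.comp_left rfl
  have hg₂ : ContDiff ℝ ∞ (Complex.ofRealCLM ∘ φ) := by fun_prop
  set ψ : 𝓢(V, ℂ) := hg₁.toSchwartzMap hg₂ with hψ
  have hψv : ∀ x, ψ x = (φ x : ℂ) := fun x => rfl
  have e1 := congrArg (fun T => T ψ) (Lp.fourierInv_toTemperedDistribution_eq (h2.toLp h))
  simp only [TemperedDistribution.fourierInv_apply, Lp.toTemperedDistribution_apply] at e1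
  calc ∫ x, φ x • (𝓕⁻ (h2.toLp h) : Lp ℂ 2 (volume : Measure V)) x
      = ∫ x, (𝓕⁻ ψ) x • (h2.toLp h) x := by rw [e1]; simp [hψv]
    _ = ∫ x, (𝓕⁻ (ψ : V → ℂ)) x • h x := by
        refine integral_congr_ae ?_
        filter_upwards [h2.coeFn_toLp] with x hx
        rw [hx, SchwartzMap.fourierInv_coe]
    _ = ∫ x, ψ x • (𝓕⁻ h) x := by
        have := VectorFourier.integral_fourierIntegral_smul_eq_flip (μ := (volume : Measure V))
          (ν := (volume : Measure V)) (L := -(innerₗ V))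
          (f := ψ) (g := h) Real.continuous_fourierChar
          (continuous_inner (𝕜 := ℝ) (E := V)).neg ψ.integrable h1
        have flip : (-(innerₗ V)).flip = -(innerₗ V) := by
          ext a b; simp [real_inner_comm]
        rw [flip] at this
        exact this
    _ = _ := by simp [hψv]

/-- Plancherel's theorem for the Fourier integral on `L¹ ∩ L²`. -/
theorem eLpNorm_fourierInv {h : V → ℂ} (h1 : Integrable h) (h2 : MemLp h 2) :
    eLpNorm (𝓕⁻ h) 2 volume = eLpNorm h 2 volume := by
  rw [← eLpNorm_congr_ae (coeFn_fourierInv_toLp h1 h2), ← eLpNorm_congr_ae h2.coeFn_toLp,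
    ← Lp.enorm_def, ← Lp.enorm_def]
  have : ‖(𝓕⁻ (h2.toLp h) : Lp ℂ 2 (volume : Measure V))‖ = ‖h2.toLp h‖ :=
    (Lp.fourierTransformₗᵢ V ℂ).symm.norm_map _
  rw [← ofReal_norm, ← ofReal_norm, this]
end

/-! ### Mean values and shifts of contours -/

/-- The sub-mean value inequality for the square of a holomorphic function on a disc. -/
lemma enorm_sq_mul_le_lintegral_ball {f : ℂ → ℂ} {c : ℂ} {R : ℝ} (hR : 0 < R)
    (hf : DifferentiableOn ℂ f (Metric.ball c R)) :
    ‖f c‖ₑ ^ 2 * ENNReal.ofReal (Real.pi * R ^ 2) ≤ ∫⁻ z in Metric.ball c R, ‖f z‖ₑ ^ 2 := by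
  have hcirc : ∀ r ∈ Set.Ioo 0 R, ‖f c‖ₑ ^ 2 * ENNReal.ofReal (2 * Real.pi) ≤
      ∫⁻ θ in Set.Ioo (-Real.pi) Real.pi, ‖f (circleMap c r θ)‖ₑ ^ 2 := fun r hr => by
    have hf2 : DifferentiableOn ℂ (fun z => f z ^ 2) (Metric.ball c R) := hf.pow 2
    have hcl : DiffContOnCl ℂ (fun z => f z ^ 2) (Metric.ball c |r|) := by
      apply DifferentiableOn.diffContOnCl
      refine hf2.mono ?_
      rw [abs_of_pos hr.1]
      exact Metric.closure_ball_subset_closedBall.trans (Metric.closedBall_subset_ball hr.2)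
    have h1 := hcl.circleAverage
    rw [Real.circleAverage_eq_integral_add (-Real.pi)] at h1
    -- Polar coordinates use the angles in `(-π, π)`, circle averages those in `(0, 2π)`.
    have hper : ∫ θ in (0:ℝ)..2 * Real.pi, f (circleMap c r (θ + -Real.pi)) ^ 2 =
        ∫ θ in Set.Ioo (-Real.pi) Real.pi, f (circleMap c r θ) ^ 2 := by
      rw [intervalIntegral.integral_comp_add_right (fun θ => f (circleMap c r θ) ^ 2),
        intervalIntegral.integral_of_le (by linarith [Real.pi_pos]), integral_Ioc_eq_integral_Ioo]
      congr 3 <;> ring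
    rw [hper] at h1
    have h2 : f c ^ 2 * (2 * Real.pi : ℝ) =
        ∫ θ in Set.Ioo (-Real.pi) Real.pi, f (circleMap c r θ) ^ 2 := by
      rw [← h1, Complex.real_smul]
      push_cast
      field_simp
    calc ‖f c‖ₑ ^ 2 * ENNReal.ofReal (2 * Real.pi) = ‖f c ^ 2 * (2 * Real.pi : ℝ)‖ₑ := by
          rw [enorm_mul, enorm_pow]
          congr 1
          rw [← ofReal_norm, Complex.norm_real, Real.norm_of_nonneg (by positivity)]
      _ ≤ ∫⁻ θ in Set.Ioo (-Real.pi) Real.pi, ‖f (circleMap c r θ) ^ 2‖ₑ := by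
          rw [h2]; exact enorm_integral_le_lintegral_enorm _
      _ = _ := by simp only [enorm_pow]
  have hpolar := Complex.lintegral_comp_polarCoord_symm
    (fun z => (Metric.ball 0 R).indicator (fun z => ‖f (c + z)‖ₑ ^ 2) z)
  have htr : ∫⁻ z in Metric.ball c R, ‖f z‖ₑ ^ 2 =
      ∫⁻ z, (Metric.ball 0 R).indicator (fun z => ‖f (c + z)‖ₑ ^ 2) z := by
    rw [← lintegral_indicator Metric.isOpen_ball.measurableSet,
      ← lintegral_add_left_eq_self _ c]
    refine lintegral_congr fun z => ?_
    by_cases hz : z ∈ Metric.ball 0 R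
    · rw [Set.indicator_of_mem hz, Set.indicator_of_mem (by simpa using hz)]
    · rw [Set.indicator_of_notMem hz, Set.indicator_of_notMem (by simpa using hz)]
  rw [htr, ← hpolar]
  have hsub : Set.Ioo (0:ℝ) R ×ˢ Set.Ioo (-Real.pi) Real.pi ⊆ polarCoord.target := by
    rw [polarCoord_target]
    exact Set.prod_mono (fun x hx => hx.1) le_rfl
  have hmeas : AEMeasurable (fun p : ℝ × ℝ => ENNReal.ofReal p.1 * ‖f (circleMap c p.1 p.2)‖ₑ ^ 2)
      ((volume.restrict (Set.Ioo (0:ℝ) R)).prod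
        (volume.restrict (Set.Ioo (-Real.pi) Real.pi))) := by
    rw [Measure.prod_restrict]
    refine AEMeasurable.mul measurable_fst.ennreal_ofReal.aemeasurable ?_
    have hc : ContinuousOn (fun p : ℝ × ℝ => f (circleMap c p.1 p.2))
        (Set.Ioo (0:ℝ) R ×ˢ Set.Ioo (-Real.pi) Real.pi) := by
      refine hf.continuousOn.comp ?_ fun p hp => ?_
      · unfold circleMap; fun_prop
      · simp [circleMap, dist_eq_norm, abs_of_pos hp.1.1, hp.1.2]
    exact (hc.aemeasurable (measurableSet_Ioo.prod measurableSet_Ioo)).enorm.pow_const 2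
  calc ‖f c‖ₑ ^ 2 * ENNReal.ofReal (Real.pi * R ^ 2)
      = ∫⁻ r in Set.Ioo 0 R, ENNReal.ofReal r * (‖f c‖ₑ ^ 2 * ENNReal.ofReal (2 * Real.pi)) := by
        rw [lintegral_mul_const _ (by fun_prop),
          ← ofReal_integral_eq_lintegral_ofReal, ← integral_Ioc_eq_integral_Ioo,
          ← intervalIntegral.integral_of_le hR.le, integral_id, mul_left_comm,
          ← ENNReal.ofReal_mul (by nlinarith)]
        · congr 2; ring
        · exact (continuous_id.integrableOn_Icc).mono_set Set.Ioo_subset_Icc_self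
        · exact (ae_restrict_iff' measurableSet_Ioo).2 (ae_of_all _ fun r hr => hr.1.le)
    _ ≤ ∫⁻ r in Set.Ioo 0 R, ENNReal.ofReal r *
          ∫⁻ θ in Set.Ioo (-Real.pi) Real.pi, ‖f (circleMap c r θ)‖ₑ ^ 2 := by
        refine setLIntegral_mono' measurableSet_Ioo fun r hr => ?_
        gcongr
        exact hcirc r hr
    _ = ∫⁻ r in Set.Ioo 0 R, ∫⁻ θ in Set.Ioo (-Real.pi) Real.pi,
          ENNReal.ofReal r * ‖f (circleMap c r θ)‖ₑ ^ 2 := by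
        refine lintegral_congr fun r => ?_
        rw [lintegral_const_mul' _ _ ENNReal.ofReal_ne_top]
    _ = ∫⁻ p in Set.Ioo (0:ℝ) R ×ˢ Set.Ioo (-Real.pi) Real.pi,
          ENNReal.ofReal p.1 * ‖f (circleMap c p.1 p.2)‖ₑ ^ 2 := by
        rw [lintegral_lintegral hmeas, Measure.prod_restrict]; rfl
    _ = ∫⁻ p in Set.Ioo (0:ℝ) R ×ˢ Set.Ioo (-Real.pi) Real.pi,
          ENNReal.ofReal p.1 • (Metric.ball 0 R).indicator (fun z => ‖f (c + z)‖ₑ ^ 2)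
            (Complex.polarCoord.symm p) := by
        refine setLIntegral_congr_fun (measurableSet_Ioo.prod measurableSet_Ioo) fun p hp => ?_
        have hmem : Complex.polarCoord.symm p ∈ Metric.ball (0:ℂ) R := by
          rw [mem_ball_zero_iff, Complex.norm_polarCoord_symm, abs_of_pos hp.1.1]
          exact hp.1.2
        simp only [Set.indicator_of_mem hmem, smul_eq_mul]
        congr 4
        rw [Complex.polarCoord_symm_apply, circleMap, Complex.exp_mul_I]
        push_cast; rfl
    _ ≤ _ := lintegral_mono_set hsub

/-- Cauchy's theorem on a vertical strip: the integral along a vertical line does not depend on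
the line. -/
lemma integral_vertical_eq {f : ℂ → ℂ} {a b : ℝ} {B : ℝ → ℝ}
    (hf : ∀ z : ℂ, z.re ∈ Set.uIcc a b → DifferentiableAt ℂ f z)
    (hB : ∀ x ∈ Set.uIcc a b, ∀ y : ℝ, ‖f ⟨x, y⟩‖ ≤ B y) (hBi : Integrable B)
    (hBt : Tendsto B atTop (𝓝 0)) (hBb : Tendsto B atBot (𝓝 0)) :
    ∫ y : ℝ, f ⟨a, y⟩ = ∫ y : ℝ, f ⟨b, y⟩ := by
  have hint : ∀ x ∈ Set.uIcc a b, Integrable fun y : ℝ => f ⟨x, y⟩ := fun x hx => by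
    refine hBi.mono' ?_ (ae_of_all _ fun y => hB x hx y)
    refine Continuous.aestronglyMeasurable ?_
    refine continuous_iff_continuousAt.2 fun y => ?_
    exact ContinuousAt.comp (f := fun y : ℝ => (⟨x, y⟩ : ℂ)) (hf ⟨x, y⟩ hx).continuousAt
      (by simp only [Complex.mk_eq_add_mul_I]; fun_prop)
  have hrect : ∀ N : ℝ, (∫ y : ℝ in -N..N, f ⟨a, y⟩) - ∫ y : ℝ in -N..N, f ⟨b, y⟩ =
      Complex.I * ((∫ x : ℝ in a..b, f ⟨x, N⟩) - ∫ x : ℝ in a..b, f ⟨x, -N⟩) := fun N => by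
    have := Complex.integral_boundary_rect_eq_zero_of_differentiableOn f ⟨a, -N⟩ ⟨b, N⟩
      (fun z hz => (hf z hz.1).differentiableWithinAt)
    simp only [smul_eq_mul, ← Complex.mk_eq_add_mul_I] at this
    linear_combination Complex.I * this +
      ((∫ y : ℝ in -N..N, f ⟨a, y⟩) - ∫ y : ℝ in -N..N, f ⟨b, y⟩) * Complex.I_sq
  have hh : ∀ N : ℝ, ‖∫ x : ℝ in a..b, f ⟨x, N⟩‖ ≤ B N * |b - a| := fun N =>
    intervalIntegral.norm_integral_le_of_norm_le_const fun x hx =>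
      hB x (Set.uIoc_subset_uIcc hx) N
  have h1 : Tendsto (fun N : ℝ => ∫ x : ℝ in a..b, f ⟨x, N⟩) atTop (𝓝 0) :=
    squeeze_zero_norm hh (by simpa using hBt.mul_const |b - a|)
  have h2 : Tendsto (fun N : ℝ => ∫ x : ℝ in a..b, f ⟨x, -N⟩) atTop (𝓝 0) :=
    squeeze_zero_norm (fun N => hh (-N))
      (by simpa using (hBb.comp tendsto_neg_atTop_atBot).mul_const |b - a|)
  have h3 := (h1.sub h2).const_mul Complex.I
  have h4 := (intervalIntegral_tendsto_integral (hint a Set.left_mem_uIcc)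
    tendsto_neg_atTop_atBot tendsto_id).sub (intervalIntegral_tendsto_integral
      (hint b Set.right_mem_uIcc) tendsto_neg_atTop_atBot tendsto_id)
  simp only [id, hrect] at h4
  have := tendsto_nhds_unique h4 h3
  rw [sub_self, mul_zero] at this
  exact sub_eq_zero.1 this

/-- The version of `integral_vertical_eq` for horizontal lines. -/
lemma integral_horizontal_eq {f : ℂ → ℂ} {a b : ℝ} {B : ℝ → ℝ}
    (hf : ∀ z : ℂ, z.im ∈ Set.uIcc a b → DifferentiableAt ℂ f z)
    (hB : ∀ s ∈ Set.uIcc a b, ∀ t : ℝ, ‖f ⟨t, s⟩‖ ≤ B t) (hBi : Integrable B)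
    (hBt : Tendsto B atTop (𝓝 0)) (hBb : Tendsto B atBot (𝓝 0)) :
    ∫ t : ℝ, f ⟨t, a⟩ = ∫ t : ℝ, f ⟨t, b⟩ := by
  have e : ∀ x y : ℝ, Complex.I * ⟨x, y⟩ = (⟨-y, x⟩ : ℂ) := fun x y => by
    apply Complex.ext <;> simp
  have := integral_vertical_eq (f := fun z => f (Complex.I * z)) (a := a) (b := b)
    (B := fun y => B (-y))
    (fun z hz => DifferentiableAt.comp z (hf _ (by simpa using hz)) (by fun_prop))
    (fun x hx y => by rw [e]; exact hB x hx (-y)) hBi.comp_neg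
    (hBb.comp tendsto_neg_atTop_atBot) (hBt.comp tendsto_neg_atBot_atTop)
  simp only [e] at this
  rwa [integral_neg_eq_self (fun y => f ⟨y, a⟩), integral_neg_eq_self (fun y => f ⟨y, b⟩)] at this

/-! ### The weight of the frequency space -/

/-- The weight `N(v) = ∫ exp (4π (η x - τ b(x))) dx` of the frequency `v = η + i τ`: the mass
of `|exp (freqForm v ·)|²` over `x` on the boundary of the tube domain. -/
def weight (b : ℝ → ℝ) (v : ℂ) : ENNReal :=
  ∫⁻ x : ℝ, ‖Complex.exp (freqForm v (tubePoint b x 0 0 0))‖ₑ ^ 2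

/-- Lebesgue measure on the half-plane `τ > 0` of frequencies. -/
def halfMeasure : Measure ℂ := volume.restrict {v | 0 < v.im}

/-- The weighted measure `N(v) dv` on the half-plane of frequencies. -/
def weightMeasure (b : ℝ → ℝ) : Measure ℂ := halfMeasure.withDensity (weight b)

/-- The Laplace integral `∫ exp (2π (η z₁ + i τ z₂)) f(η, τ) dη dτ` over `τ > 0`. -/
def laplace (f : ℂ → ℂ) (z : ℂ × ℂ) : ℂ := ∫ v, Complex.exp (freqForm v z) * f v ∂halfMeasure

lemma enorm_exp_freqForm_sq (v : ℂ) (z : ℂ × ℂ) :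
    ‖Complex.exp (freqForm v z)‖ₑ ^ 2 =
      ENNReal.ofReal (Real.exp (4 * Real.pi * (v.re * z.1.re - v.im * z.2.im))) := by
  rw [← ofReal_norm, Complex.norm_exp, freqForm_re, ← ENNReal.ofReal_pow (Real.exp_pos _).le,
    ← Real.exp_nat_mul]
  congr 2; push_cast; ring

lemma weight_eq (b : ℝ → ℝ) (v : ℂ) : weight b v =
    ∫⁻ x : ℝ, ENNReal.ofReal (Real.exp (4 * Real.pi * (v.re * x - v.im * b x))) := by
  simp [weight, enorm_exp_freqForm_sq, tubePoint]

lemma measurableSet_half : MeasurableSet {v : ℂ | 0 < v.im} :=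
  measurableSet_lt measurable_const Complex.measurable_im

lemma ae_half : ∀ᵐ v ∂halfMeasure, 0 < v.im := ae_restrict_mem measurableSet_half

lemma continuous_freqForm_uncurry : Continuous fun p : ℂ × (ℂ × ℂ) => freqForm p.1 p.2 := by
  simp only [freqForm_apply]
  fun_prop

instance : SFinite halfMeasure := by unfold halfMeasure; infer_instance

section
variable {b : ℝ → ℝ} (hb : Continuous b)
include hb

lemma continuous_tubePoint_zero (h : ℝ) : Continuous fun x : ℝ => tubePoint b x 0 0 h := by
  simp only [tubePoint, Complex.mk_eq_add_mul_I]
  fun_prop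

lemma continuous_tubePoint (h : ℝ) :
    Continuous fun u : ℝ × ℝ × ℝ => tubePoint b u.1 u.2.1 u.2.2 h := by
  simp only [tubePoint, Complex.mk_eq_add_mul_I]
  fun_prop

lemma measurable_weight : Measurable (weight b) := by
  refine Measurable.lintegral_prod_right' (f := fun p : ℂ × ℝ =>
    ‖Complex.exp (freqForm p.1 (tubePoint b p.2 0 0 0))‖ₑ ^ 2) ?_
  refine Measurable.pow_const (Continuous.measurable ?_).enorm 2
  exact (continuous_freqForm_uncurry.comp
    (continuous_fst.prodMk ((continuous_tubePoint_zero hb 0).comp continuous_snd))).cexp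

lemma weight_ne_zero (v : ℂ) : weight b v ≠ 0 := by
  rw [weight, Ne, lintegral_eq_zero_iff]
  · intro h
    have : ∀ᵐ x : ℝ, False := by
      filter_upwards [h] with x hx
      simp at hx
    rw [ae_iff] at this
    simp at this
  · exact (((freqForm v).continuous.comp
      (continuous_tubePoint_zero hb 0)).cexp.measurable.enorm).pow_const 2
end

lemma integrable_exp_neg_abs_add {c : ℝ} (hc : 0 < c) :
    Integrable fun v : ℂ => Real.exp (-(c * (|v.re| + |v.im|))) := by
  have h1 : Integrable fun x : ℝ => Real.exp (-(c * |x|)) := by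
    rw [← integrableOn_univ, ← Set.Iic_union_Ioi (a := (0:ℝ))]
    refine IntegrableOn.union ?_ ?_
    · refine (integrableOn_exp_mul_Iic hc 0).congr_fun (fun x hx => ?_) measurableSet_Iic
      simp only [abs_of_nonpos (Set.mem_Iic.1 hx)]; ring_nf
    · refine (integrableOn_exp_mul_Ioi (neg_lt_zero.2 hc) 0).congr_fun (fun x hx => ?_)
        measurableSet_Ioi
      simp only [abs_of_pos (Set.mem_Ioi.1 hx)]; ring_nf
  have h2 := (h1.mul_prod h1)
  rw [← Measure.volume_eq_prod] at h2
  have h3 := Complex.volume_preserving_equiv_real_prod.integrable_comp_of_integrable h2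
  refine h3.congr (ae_of_all _ fun v => ?_)
  simp only [Function.comp, Complex.measurableEquivRealProd_apply, ← Real.exp_add]
  ring_nf

/-- The weight dominates `|exp (freqForm v z)|²` with exponential room, at every point `z` of the
tube domain. -/
lemma exists_enorm_sq_div_weight_le {b : ℝ → ℝ} (hb : Continuous b) {z : ℂ × ℂ}
    (hz : z ∈ tubeDomain b) :
    ∃ C c : ℝ, 0 < c ∧ ∀ v : ℂ, 0 < v.im →
      ‖Complex.exp (freqForm v z)‖ₑ ^ 2 * (weight b v)⁻¹ ≤
        ENNReal.ofReal (C * Real.exp (-(c * (|v.re| + |v.im|)))) := by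
  set x₀ := z.1.re
  set s := z.2.im
  have hz' : b x₀ < s := hz
  set r := (s - b x₀) / 2 with hr
  have hr0 : 0 < r := by rw [hr]; linarith
  obtain ⟨δ, hδ, hδb⟩ := Metric.continuousAt_iff.1 hb.continuousAt r hr0
  have hbx : ∀ x, |x - x₀| < δ → b x ≤ s - r := fun x hx => by
    have := hδb (x := x) (by rwa [Real.dist_eq])
    rw [Real.dist_eq] at this
    have := (abs_lt.1 this).2
    rw [hr] at this ⊢; linarith
  have hpi := Real.pi_pos
  set c := min (2 * Real.pi * δ) (4 * Real.pi * r)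
  have hc0 : 0 < c := lt_min (by positivity) (by positivity)
  refine ⟨2 / δ, c, hc0, fun v hv => ?_⟩
  set A := Real.exp (4 * Real.pi * (v.re * x₀ - v.im * s)) with hA
  have hlow : ENNReal.ofReal (A * Real.exp (c * (|v.re| + |v.im|)) * (δ / 2)) ≤ weight b v := by
    have hexp : ∀ x : ℝ, |x - x₀| < δ → |v.re| * (δ / 2) ≤ v.re * (x - x₀) →
        A * Real.exp (c * (|v.re| + |v.im|)) ≤
          Real.exp (4 * Real.pi * (v.re * x - v.im * b x)) := fun x hx hx' => by
      rw [hA, ← Real.exp_add]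
      apply Real.exp_le_exp.2
      have h1 : c * |v.re| ≤ 2 * Real.pi * δ * |v.re| :=
        mul_le_mul_of_nonneg_right (min_le_left _ _) (abs_nonneg _)
      have h2 : c * |v.im| ≤ 4 * Real.pi * r * |v.im| :=
        mul_le_mul_of_nonneg_right (min_le_right _ _) (abs_nonneg _)
      rw [abs_of_pos hv] at h2 ⊢
      have h3 := mul_le_mul_of_nonneg_left (hbx x hx) hv.le
      have h4 := mul_le_mul_of_nonneg_left hx' hpi.le
      have h5 := mul_le_mul_of_nonneg_left h3 hpi.le
      nlinarith
    rw [weight_eq, ENNReal.ofReal_mul (by positivity)]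
    have key : ∀ I : Set ℝ, MeasurableSet I → volume I = ENNReal.ofReal (δ / 2) →
        (∀ x ∈ I, |x - x₀| < δ ∧ |v.re| * (δ / 2) ≤ v.re * (x - x₀)) →
        ENNReal.ofReal (A * Real.exp (c * (|v.re| + |v.im|))) * ENNReal.ofReal (δ / 2) ≤
        ∫⁻ x : ℝ, ENNReal.ofReal (Real.exp (4 * Real.pi * (v.re * x - v.im * b x))) :=
      fun I hI hvol hmem => by
        rw [← hvol, ← setLIntegral_const]
        refine (setLIntegral_mono' hI fun x hx => ?_).trans (setLIntegral_le_lintegral I _)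
        exact ENNReal.ofReal_le_ofReal (hexp x (hmem x hx).1 (hmem x hx).2)
    -- Integrate over the side of `x₀` on which `η x` is larger than `η x₀`.
    rcases le_total 0 v.re with h | h
    · refine key (Set.Ioo (x₀ + δ / 2) (x₀ + δ)) measurableSet_Ioo ?_ fun x hx => ⟨?_, ?_⟩
      · rw [Real.volume_Ioo]; congr 1; ring
      · rw [abs_lt]; constructor <;> linarith [hx.1, hx.2]
      · rw [abs_of_nonneg h]
        exact mul_le_mul_of_nonneg_left (by linarith [hx.1]) h
    · refine key (Set.Ioo (x₀ - δ) (x₀ - δ / 2)) measurableSet_Ioo ?_ fun x hx => ⟨?_, ?_⟩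
      · rw [Real.volume_Ioo]; congr 1; ring
      · rw [abs_lt]; constructor <;> linarith [hx.1, hx.2]
      · rw [abs_of_nonpos h]
        nlinarith [mul_nonneg (neg_nonneg.2 h) (by linarith [hx.2] : 0 ≤ x₀ - δ / 2 - x)]
  have hpos : 0 < A * Real.exp (c * (|v.re| + |v.im|)) * (δ / 2) := by positivity
  calc ‖Complex.exp (freqForm v z)‖ₑ ^ 2 * (weight b v)⁻¹
      ≤ ENNReal.ofReal A * (ENNReal.ofReal (A * Real.exp (c * (|v.re| + |v.im|)) * (δ / 2)))⁻¹ := by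
        rw [enorm_exp_freqForm_sq]
        gcongr
    _ = _ := by
        rw [← ENNReal.ofReal_inv_of_pos hpos, ← ENNReal.ofReal_mul (by positivity)]
        congr 1
        have hA0 : A ≠ 0 := (Real.exp_pos _).ne'
        rw [Real.exp_neg]
        field_simp

/-- The reproducing kernel of the Laplace integrals converges at every point of the tube domain. -/
lemma lintegral_enorm_sq_div_weight_lt_top {b : ℝ → ℝ} (hb : Continuous b) {z : ℂ × ℂ}
    (hz : z ∈ tubeDomain b) :
    ∫⁻ v, ‖Complex.exp (freqForm v z)‖ₑ ^ 2 * (weight b v)⁻¹ ∂halfMeasure < ⊤ := by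
  obtain ⟨C, c, hc, h⟩ := exists_enorm_sq_div_weight_le hb hz
  refine (lintegral_mono_ae (ae_half.mono h)).trans_lt ?_
  have hi : Integrable (fun v : ℂ => C * Real.exp (-(c * (|v.re| + |v.im|)))) halfMeasure :=
    ((integrable_exp_neg_abs_add hc).const_mul C).restrict
  exact hi.lintegral_lt_top

/-- The inequality between the arithmetic and the geometric mean, in weighted form. -/
lemma ENNReal.mul_le_sq_mul_inv_add_sq_mul (x y : ENNReal) {N : ENNReal} (hN : N ≠ 0) :
    x * y ≤ x ^ 2 * N⁻¹ + y ^ 2 * N := by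
  rcases eq_or_ne N ⊤ with rfl | hN'
  · rcases eq_or_ne y 0 with rfl | hy
    · simp
    · simp [hy]
  rcases le_total x (y * N) with h | h
  · calc x * y ≤ y * N * y := by gcongr
      _ = y ^ 2 * N := by ring
      _ ≤ _ := le_add_self
  · have h' : y ≤ x * N⁻¹ := by
      rw [← div_eq_mul_inv]; exact (ENNReal.le_div_iff_mul_le (Or.inl hN) (Or.inl hN')).2 h
    calc x * y ≤ x * (x * N⁻¹) := by gcongr
      _ = x ^ 2 * N⁻¹ := by ring
      _ ≤ _ := le_self_add

lemma eLpNorm_two_sq {α : Type*} [MeasurableSpace α] {μ : Measure α} (g : α → ℂ) :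
    eLpNorm g 2 μ ^ 2 = ∫⁻ x, ‖g x‖ₑ ^ 2 ∂μ := by
  have := eLpNorm_nnreal_pow_eq_lintegral (f := g) (μ := μ) (p := 2) (by norm_num)
  simpa using this

lemma memLp_two_iff {α : Type*} [MeasurableSpace α] {μ : Measure α} {g : α → ℂ} :
    MemLp g 2 μ ↔ AEStronglyMeasurable g μ ∧ ∫⁻ x, ‖g x‖ₑ ^ 2 ∂μ < ⊤ := by
  rw [MemLp, ← eLpNorm_two_sq, ENNReal.pow_lt_top_iff]
  simp

section
variable {b : ℝ → ℝ} (hb : Continuous b) {f : ℂ → ℂ}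
include hb

lemma halfMeasure_absolutelyContinuous : halfMeasure ≪ weightMeasure b :=
  withDensity_absolutelyContinuous' (measurable_weight hb).aemeasurable
    (ae_of_all _ fun v => weight_ne_zero hb v)

lemma aestronglyMeasurable_half (hf : AEStronglyMeasurable f (weightMeasure b)) :
    AEStronglyMeasurable f halfMeasure :=
  hf.mono_ac (halfMeasure_absolutelyContinuous hb)

lemma lintegral_weightMeasure {F : ℂ → ENNReal} (hF : AEMeasurable F halfMeasure) :
    ∫⁻ v, F v ∂weightMeasure b = ∫⁻ v, F v * weight b v ∂halfMeasure := by
  rw [weightMeasure, lintegral_withDensity_eq_lintegral_mul₀ (measurable_weight hb).aemeasurable hF]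
  exact lintegral_congr fun v => mul_comm _ _

lemma lintegral_sq_mul_weight_lt_top (hf : MemLp f 2 (weightMeasure b)) :
    ∫⁻ v, ‖f v‖ₑ ^ 2 * weight b v ∂halfMeasure < ⊤ := by
  rw [← lintegral_weightMeasure hb
    ((aestronglyMeasurable_half hb hf.1).enorm.pow_const 2)]
  exact (memLp_two_iff.1 hf).2

/-- The Laplace integral of a function in the weighted `L²` space converges absolutely wherever the
reproducing kernel converges. -/
lemma integrable_exp_mul_of_memLp (hf : MemLp f 2 (weightMeasure b)) {z : ℂ × ℂ}
    (hz : ∫⁻ v, ‖Complex.exp (freqForm v z)‖ₑ ^ 2 * (weight b v)⁻¹ ∂halfMeasure < ⊤) :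
    Integrable (fun v => Complex.exp (freqForm v z) * f v) halfMeasure := by
  refine ⟨(continuous_freqForm_apply z).cexp.aestronglyMeasurable.mul
    (aestronglyMeasurable_half hb hf.1), ?_⟩
  have hm := (continuous_freqForm_apply z).cexp.measurable.enorm.pow_const 2
  calc ∫⁻ v, ‖Complex.exp (freqForm v z) * f v‖ₑ ∂halfMeasure
      ≤ ∫⁻ v, (‖Complex.exp (freqForm v z)‖ₑ ^ 2 * (weight b v)⁻¹ +
          ‖f v‖ₑ ^ 2 * weight b v) ∂halfMeasure := by
        refine lintegral_mono fun v => ?_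
        rw [enorm_mul]
        exact ENNReal.mul_le_sq_mul_inv_add_sq_mul _ _ (weight_ne_zero hb v)
    _ = _ := lintegral_add_left (hm.mul (measurable_weight hb).inv) _
    _ < ⊤ := ENNReal.add_lt_top.2 ⟨hz, lintegral_sq_mul_weight_lt_top hb hf⟩

lemma isOpen_tubeDomain : IsOpen (tubeDomain b) :=
  isOpen_lt (by fun_prop) (by fun_prop)

lemma integrable_exp_mul (hf : MemLp f 2 (weightMeasure b)) {z : ℂ × ℂ} (hz : z ∈ tubeDomain b) :
    Integrable (fun v => Complex.exp (freqForm v z) * f v) halfMeasure :=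
  integrable_exp_mul_of_memLp hb hf (lintegral_enorm_sq_div_weight_lt_top hb hz)

lemma differentiableOn_laplace (hf : MemLp f 2 (weightMeasure b)) :
    DifferentiableOn ℂ (laplace f) (tubeDomain b) :=
  (contDiffOn_laplace (isOpen_tubeDomain hb)
    fun _ hz => integrable_exp_mul hb hf hz).differentiableOn (by simp)

end

/-! ### Laplace integrals on the boundary of the tube domain -/

lemma freqForm_tubePoint (b : ℝ → ℝ) (v : ℂ) (x y t h : ℝ) :
    freqForm v (tubePoint b x y t h) = freqForm v (tubePoint b x 0 0 0) +
      ((2 * Real.pi * inner ℝ v (⟨y, t⟩ : ℂ) : ℝ) * Complex.I +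
        (-(2 * Real.pi * v.im * h) : ℝ)) := by
  have e : inner ℝ v (⟨y, t⟩ : ℂ) = v.re * y + v.im * t := by
    simp [Complex.inner]; ring
  rw [e]
  simp only [freqForm_apply, tubePoint, Complex.mk_eq_add_mul_I]
  push_cast
  linear_combination (2 * Real.pi * v.im * h : ℂ) * Complex.I_sq

/-- Multiplication of a function of the frequency by `exp (-2π τ ε)`, which shifts its
Laplace integral by `ε` into the tube domain. -/
def damp (ε : ℝ) (f : ℂ → ℂ) (v : ℂ) : ℂ := Real.exp (-(2 * Real.pi * v.im * ε)) * f v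

lemma exp_freqForm_tubePoint_mul (b : ℝ → ℝ) (f : ℂ → ℂ) (v : ℂ) (x y t h : ℝ) :
    Complex.exp (freqForm v (tubePoint b x y t h)) * f v =
      Complex.exp (freqForm v (tubePoint b x y t 0)) * damp h f v := by
  rw [freqForm_tubePoint b v x y t h, freqForm_tubePoint b v x y t 0, damp]
  simp only [Complex.exp_add, Complex.ofReal_exp]
  simp
  ring

lemma slice_laplace (b : ℝ → ℝ) (f : ℂ → ℂ) (ε : ℝ) :
    slice b (laplace f) ε = slice b (laplace (damp ε f)) 0 := by
  ext u
  exact integral_congr_ae (ae_of_all _ fun v => exp_freqForm_tubePoint_mul b f v _ _ _ _)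

/-- The restriction of a Laplace integral to a fibre is an inverse Fourier transform. -/
lemma laplace_tubePoint (b : ℝ → ℝ) (f : ℂ → ℂ) (x y t h : ℝ) :
    laplace f (tubePoint b x y t h) =
      𝓕⁻ ({v : ℂ | 0 < v.im}.indicator fun v =>
        Complex.exp (freqForm v (tubePoint b x 0 0 h)) * f v) (⟨y, t⟩ : ℂ) := by
  rw [Real.fourierInv_eq', laplace, halfMeasure, ← integral_indicator measurableSet_half]
  refine integral_congr_ae (ae_of_all _ fun v => ?_)
  by_cases hv : v ∈ {v : ℂ | 0 < v.im}
  · simp only [Set.indicator_of_mem hv, smul_eq_mul]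
    rw [freqForm_tubePoint b v x y t h, freqForm_tubePoint b v x 0 0 h]
    have : inner ℝ v (⟨0, 0⟩ : ℂ) = 0 := inner_zero_right v
    rw [this]
    simp only [Complex.exp_add, mul_zero, Complex.ofReal_zero, zero_mul, zero_add]
    ring
  · simp only [Set.indicator_of_notMem hv, smul_zero]

lemma lintegral_prod_eq_complex (F : ℂ → ENNReal) :
    ∫⁻ u : ℝ × ℝ, F ⟨u.1, u.2⟩ = ∫⁻ w : ℂ, F w :=
  Complex.volume_preserving_equiv_real_prod.symm.lintegral_comp_emb
    Complex.measurableEquivRealProd.symm.measurableEmbedding F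

lemma stronglyMeasurable_laplace {f : ℂ → ℂ} (hf : AEStronglyMeasurable f halfMeasure) :
    StronglyMeasurable (laplace f) := by
  have e : laplace f = laplace (hf.mk f) := by
    ext z
    refine integral_congr_ae ?_
    filter_upwards [hf.ae_eq_mk] with v hv
    rw [hv]
  rw [e]
  refine StronglyMeasurable.integral_prod_right (f := fun (z : ℂ × ℂ) (v : ℂ) =>
    Complex.exp (freqForm v z) * hf.mk f v) ?_
  refine StronglyMeasurable.mul ?_ (hf.stronglyMeasurable_mk.comp_measurable measurable_snd)
  exact (continuous_freqForm_uncurry.comp continuous_swap).cexp.stronglyMeasurable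

/-- Plancherel's theorem on a fibre of the boundary of the tube domain. -/
lemma lintegral_fibre {b : ℝ → ℝ} {f : ℂ → ℂ} {x : ℝ}
    (h1 : Integrable (fun v => Complex.exp (freqForm v (tubePoint b x 0 0 0)) * f v) halfMeasure)
    (h2 : ∫⁻ v, ‖Complex.exp (freqForm v (tubePoint b x 0 0 0)) * f v‖ₑ ^ 2 ∂halfMeasure < ⊤) :
    ∫⁻ u : ℝ × ℝ, ‖laplace f (tubePoint b x u.1 u.2 0)‖ₑ ^ 2 =
      ∫⁻ v, ‖Complex.exp (freqForm v (tubePoint b x 0 0 0)) * f v‖ₑ ^ 2 ∂halfMeasure := by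
  set g := fun v => Complex.exp (freqForm v (tubePoint b x 0 0 0)) * f v
  have g1 : Integrable ({v : ℂ | 0 < v.im}.indicator g) :=
    (integrable_indicator_iff measurableSet_half).2 h1
  have gs : MemLp g 2 halfMeasure := memLp_two_iff.2 ⟨h1.1, h2⟩
  have g2 : MemLp ({v : ℂ | 0 < v.im}.indicator g) 2 :=
    (memLp_indicator_iff_restrict measurableSet_half).2 gs
  have := eLpNorm_fourierInv g1 g2
  rw [eLpNorm_indicator_eq_eLpNorm_restrict measurableSet_half] at this
  simp only [laplace_tubePoint]
  rw [lintegral_prod_eq_complex fun w => ‖𝓕⁻ ({v : ℂ | 0 < v.im}.indicator g) w‖ₑ ^ 2,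
    ← eLpNorm_two_sq, this, eLpNorm_two_sq]
  rfl

/-- The functions in the weighted `L²` space whose Laplace integrals converge absolutely up to
the boundary of the tube domain. -/
def fibreSpace (b : ℝ → ℝ) : Submodule ℂ (ℂ → ℂ) where
  carrier := {f | MemLp f 2 (weightMeasure b) ∧ ∀ x : ℝ,
    Integrable (fun v => Complex.exp (freqForm v (tubePoint b x 0 0 0)) * f v) halfMeasure}
  add_mem' := fun hf hg => ⟨hf.1.add hg.1, fun x => by
    refine ((hf.2 x).add (hg.2 x)).congr (ae_of_all _ fun v => ?_)
    simp [mul_add]⟩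
  zero_mem' := ⟨MemLp.zero, fun x => by simp⟩
  smul_mem' := fun c f hf => ⟨hf.1.const_smul c, fun x => by
    refine ((hf.2 x).smul c).congr (ae_of_all _ fun v => ?_)
    simp only [Pi.smul_apply, smul_eq_mul]; ring⟩

lemma integrable_fibre {b : ℝ → ℝ} {f : ℂ → ℂ} (hf : f ∈ fibreSpace b) (x y t : ℝ) :
    Integrable (fun v => Complex.exp (freqForm v (tubePoint b x y t 0)) * f v) halfMeasure := by
  refine (hf.2 x).norm.mono' ?_ (ae_of_all _ fun v => ?_)
  · exact (continuous_freqForm_apply _).cexp.aestronglyMeasurable.mul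
      (aestronglyMeasurable_of_exp_mul (hf.2 x).1)
  · simp [Complex.norm_exp, freqForm_re, tubePoint]

section
variable {b : ℝ → ℝ} (hb : Continuous b) {f g : ℂ → ℂ}
include hb

/-- The boundary Laplace integral is isometric from the weighted `L²` space to `L²` of the
boundary. -/
theorem lintegral_slice_laplace (hf : f ∈ fibreSpace b) :
    ∫⁻ u, ‖slice b (laplace f) 0 u‖ₑ ^ 2 = ∫⁻ v, ‖f v‖ₑ ^ 2 ∂weightMeasure b := by
  have hfm := aestronglyMeasurable_half hb hf.1.1
  have hmeas : Measurable fun u : ℝ × ℝ × ℝ => ‖slice b (laplace f) 0 u‖ₑ ^ 2 :=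
    (((stronglyMeasurable_laplace hfm).measurable.comp
      (continuous_tubePoint hb 0).measurable).enorm).pow_const 2
  have hfun : AEMeasurable (Function.uncurry fun (x : ℝ) (v : ℂ) =>
      ‖Complex.exp (freqForm v (tubePoint b x 0 0 0)) * f v‖ₑ ^ 2)
      ((volume : Measure ℝ).prod halfMeasure) := by
    refine (AEMeasurable.mul ?_ hfm.aemeasurable.comp_snd).enorm.pow_const 2
    refine Continuous.aemeasurable ?_
    exact (continuous_freqForm_uncurry.comp
      (continuous_snd.prodMk ((continuous_tubePoint_zero hb 0).comp continuous_fst))).cexp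
  have hswap : ∫⁻ x : ℝ, ∫⁻ v, ‖Complex.exp (freqForm v (tubePoint b x 0 0 0)) * f v‖ₑ ^ 2
      ∂halfMeasure = ∫⁻ v, ‖f v‖ₑ ^ 2 ∂weightMeasure b := by
    rw [lintegral_lintegral_swap hfun,
      lintegral_weightMeasure hb (hfm.enorm.pow_const 2)]
    refine lintegral_congr fun v => ?_
    simp only [enorm_mul, mul_pow]
    rw [lintegral_mul_const, mul_comm, weight]
    exact (((freqForm v).continuous.comp
      (continuous_tubePoint_zero hb 0)).cexp.measurable.enorm).pow_const 2
  have hae : ∀ᵐ x : ℝ, ∫⁻ v, ‖Complex.exp (freqForm v (tubePoint b x 0 0 0)) * f v‖ₑ ^ 2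
      ∂halfMeasure < ⊤ := by
    refine ae_lt_top' hfun.lintegral_prod_right' ?_
    rw [hswap]
    exact (memLp_two_iff.1 hf.1).2.ne
  rw [Measure.volume_eq_prod, lintegral_prod _ hmeas.aemeasurable, ← hswap]
  refine lintegral_congr_ae ?_
  filter_upwards [hae] with x hx
  exact lintegral_fibre (hf.2 x) hx

lemma memLp_slice_laplace (hf : f ∈ fibreSpace b) : MemLp (slice b (laplace f) 0) 2 := by
  refine memLp_two_iff.2 ⟨?_, ?_⟩
  · exact ((stronglyMeasurable_laplace (aestronglyMeasurable_half hb hf.1.1)).comp_measurable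
      (continuous_tubePoint hb 0).measurable).aestronglyMeasurable
  · rw [lintegral_slice_laplace hb hf]
    exact (memLp_two_iff.1 hf.1).2

omit hb in
/-- The inclusion of `fibreSpace b` in the weighted `L²` space. -/
def fibreToLp (b : ℝ → ℝ) : fibreSpace b →ₗ[ℂ] Lp ℂ 2 (weightMeasure b) where
  toFun f := f.2.1.toLp f.1
  map_add' f g := MemLp.toLp_add f.2.1 g.2.1
  map_smul' c f := MemLp.toLp_const_smul c f.2.1

/-- The Laplace integral as a linear map from `fibreSpace b` to `L²` of the boundary. -/
def boundaryLaplace : fibreSpace b →ₗ[ℂ] Lp ℂ 2 (volume : Measure (ℝ × ℝ × ℝ)) where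
  toFun f := (memLp_slice_laplace hb f.2).toLp (slice b (laplace f.1) 0)
  map_add' f g := by
    rw [← MemLp.toLp_add]
    congr 1
    ext u
    simp only [slice, laplace, Pi.add_apply, Submodule.coe_add, mul_add]
    exact integral_add (integrable_fibre f.2 _ _ _) (integrable_fibre g.2 _ _ _)
  map_smul' c f := by
    rw [RingHom.id_apply, ← MemLp.toLp_const_smul]
    congr 1
    ext u
    simp only [slice, laplace, Pi.smul_apply, Submodule.coe_smul, smul_eq_mul]
    rw [← integral_const_mul]
    congr 1; ext v; ring

lemma norm_boundaryLaplace (f : fibreSpace b) : ‖boundaryLaplace hb f‖ = ‖fibreToLp b f‖ := by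
  simp only [boundaryLaplace, fibreToLp, LinearMap.coe_mk, AddHom.coe_mk, Lp.norm_toLp]
  congr 1
  have := lintegral_slice_laplace hb f.2
  rw [← eLpNorm_two_sq, ← eLpNorm_two_sq] at this
  exact (ENNReal.pow_right_strictMono two_ne_zero).injective this

lemma dist_boundaryLaplace (f g : fibreSpace b) :
    dist (boundaryLaplace hb f) (boundaryLaplace hb g) =
      dist (fibreToLp b f) (fibreToLp b g) := by
  rw [dist_eq_norm, dist_eq_norm, ← map_sub, ← map_sub, norm_boundaryLaplace]

lemma inner_boundaryLaplace (f g : fibreSpace b) :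
    inner ℂ (boundaryLaplace hb f) (boundaryLaplace hb g) =
      inner ℂ (fibreToLp b f) (fibreToLp b g) := by
  simp only [inner_eq_sum_norm_sq_div_four, ← map_smul, ← map_add, ← map_sub, norm_boundaryLaplace]

/-! ### Boundary values -/

omit hb in
lemma ENNReal.tendsto_zero_of_sq {ι : Type*} {l : Filter ι} {a : ι → ENNReal}
    (h : Tendsto (fun i => a i ^ 2) l (𝓝 0)) : Tendsto a l (𝓝 0) := by
  have := ((ENNReal.continuous_rpow_const (y := 1 / 2)).tendsto 0).comp h
  rw [ENNReal.zero_rpow_of_pos (by norm_num)] at this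
  refine this.congr fun i => ?_
  simp only [Function.comp]
  rw [← ENNReal.rpow_natCast, ← ENNReal.rpow_mul]
  norm_num

omit hb in
lemma norm_damp_le {ε : ℝ} (hε : 0 ≤ ε) {v : ℂ} (hv : 0 < v.im) : ‖damp ε f v‖ ≤ ‖f v‖ := by
  rw [damp, norm_mul, Complex.norm_real, Real.norm_of_nonneg (Real.exp_pos _).le]
  refine mul_le_of_le_one_left (norm_nonneg _) (Real.exp_le_one_iff.2 ?_)
  have := Real.pi_pos
  have : 0 ≤ 2 * Real.pi * v.im * ε := by positivity
  linarith

omit hb in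
lemma ae_weight_half : ∀ᵐ v ∂weightMeasure b, 0 < v.im :=
  (withDensity_absolutelyContinuous _ _).ae_le ae_half

omit hb in
lemma aestronglyMeasurable_damp {μ : Measure ℂ} (hf : AEStronglyMeasurable f μ) (ε : ℝ) :
    AEStronglyMeasurable (damp ε f) μ := by
  refine AEStronglyMeasurable.mul (Continuous.aestronglyMeasurable ?_) hf
  fun_prop

omit hb in
lemma memLp_damp (hf : MemLp f 2 (weightMeasure b)) {ε : ℝ} (hε : 0 ≤ ε) :
    MemLp (damp ε f) 2 (weightMeasure b) :=
  hf.of_le (aestronglyMeasurable_damp hf.1 ε) (ae_weight_half.mono fun _ hv => norm_damp_le hε hv)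

lemma damp_mem_fibreSpace (hf : MemLp f 2 (weightMeasure b)) {ε : ℝ} (hε : 0 < ε) :
    damp ε f ∈ fibreSpace b := by
  refine ⟨memLp_damp hf hε.le, fun x => ?_⟩
  have := integrable_exp_mul hb hf (z := tubePoint b x 0 0 ε) (by simp [tubeDomain, tubePoint, hε])
  exact this.congr (ae_of_all _ fun v => exp_freqForm_tubePoint_mul b f v _ _ _ _)

omit hb in
lemma tendsto_damp (hf : MemLp f 2 (weightMeasure b)) :
    Tendsto (fun ε : Set.Ioi (0:ℝ) => (memLp_damp hf (le_of_lt ε.2)).toLp (damp ε f))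
      (comap Subtype.val (𝓝[>] 0)) (𝓝 (hf.toLp f)) := by
  rw [Lp.tendsto_Lp_iff_tendsto_eLpNorm'']
  have key : Tendsto (fun ε : Set.Ioi (0:ℝ) =>
      ∫⁻ v, ‖damp ε f v - f v‖ₑ ^ 2 ∂weightMeasure b) (comap Subtype.val (𝓝[>] 0)) (𝓝 0) := by
    have : (0 : ENNReal) = ∫⁻ v, (0:ENNReal) ∂weightMeasure b := by simp
    rw [this]
    refine tendsto_lintegral_filter_of_dominated_convergence' (fun v => (2 * ‖f v‖ₑ) ^ 2)
      (Eventually.of_forall fun ε =>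
        ((aestronglyMeasurable_damp hf.1 _).sub hf.1).enorm.pow_const 2)
      (Eventually.of_forall fun ε => ?_) ?_ (ae_of_all _ fun v => ?_)
    · filter_upwards [ae_weight_half] with v hv
      gcongr
      calc ‖damp ε f v - f v‖ₑ ≤ ‖damp ε f v‖ₑ + ‖f v‖ₑ := enorm_sub_le
        _ ≤ ‖f v‖ₑ + ‖f v‖ₑ := by
          gcongr
          exact enorm_le_iff_norm_le.2 (norm_damp_le (le_of_lt ε.2) hv)
        _ = 2 * ‖f v‖ₑ := (two_mul _).symm
    · simp only [mul_pow]
      rw [lintegral_const_mul' _ _ (by norm_num)]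
      exact ENNReal.mul_ne_top (by norm_num) (memLp_two_iff.1 hf).2.ne
    · have hc : Continuous fun ε : ℝ => ‖damp ε f v - f v‖ₑ ^ 2 := by
        unfold damp; fun_prop
      have := ((hc.tendsto 0).mono_left nhdsWithin_le_nhds).comp
        (tendsto_comap (f := (Subtype.val : Set.Ioi (0:ℝ) → ℝ)) (x := 𝓝[>] 0))
      simpa [damp, Function.comp_def] using this
  simp only [← eLpNorm_two_sq] at key
  refine ENNReal.tendsto_zero_of_sq (key.congr fun ε => ?_)
  rfl

omit hb in
instance neBot_comap_Ioi : NeBot (comap (Subtype.val : Set.Ioi (0:ℝ) → ℝ) (𝓝[>] 0)) :=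
  NeBot.comap_of_range_mem inferInstance (by rw [Subtype.range_val]; exact self_mem_nhdsWithin)

/-- The boundary Laplace integral of `damp ε f`, that is the slice of the Laplace integral of `f` at
height `ε`. -/
def sliceLp (hf : MemLp f 2 (weightMeasure b)) (ε : Set.Ioi (0:ℝ)) :
    Lp ℂ 2 (volume : Measure (ℝ × ℝ × ℝ)) :=
  boundaryLaplace hb ⟨damp ε f, damp_mem_fibreSpace hb hf ε.2⟩

lemma coeFn_sliceLp (hf : MemLp f 2 (weightMeasure b)) (ε : Set.Ioi (0:ℝ)) :
    sliceLp hb hf ε =ᵐ[volume] slice b (laplace f) ε := by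
  rw [slice_laplace]
  exact (memLp_slice_laplace hb (damp_mem_fibreSpace hb hf ε.2)).coeFn_toLp

lemma exists_tendsto_sliceLp (hf : MemLp f 2 (weightMeasure b)) :
    ∃ Γ, Tendsto (sliceLp hb hf) (comap Subtype.val (𝓝[>] 0)) (𝓝 Γ) := by
  refine cauchy_map_iff_exists_tendsto.1 ?_
  have h := (tendsto_damp hf).cauchy_map
  rw [cauchy_map_iff] at h ⊢
  refine ⟨h.1, ?_⟩
  have h2 := h.2
  rw [Metric.uniformity_eq_comap_nhds_zero, tendsto_comap_iff] at h2 ⊢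
  refine h2.congr fun p => ?_
  exact (dist_boundaryLaplace hb ⟨_, damp_mem_fibreSpace hb hf p.1.2⟩
    ⟨_, damp_mem_fibreSpace hb hf p.2.2⟩).symm

lemma isBoundaryValue_laplace_iff (hf : MemLp f 2 (weightMeasure b)) {γ : ℝ × ℝ × ℝ → ℂ}
    (hγ : MemLp γ 2) : IsBoundaryValue b (laplace f) γ ↔
      Tendsto (sliceLp hb hf) (comap Subtype.val (𝓝[>] 0)) (𝓝 (hγ.toLp γ)) := by
  rw [IsBoundaryValue, and_iff_right hγ, Lp.tendsto_Lp_iff_tendsto_eLpNorm',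
    ← tendsto_comap'_iff (i := (Subtype.val : Set.Ioi (0:ℝ) → ℝ))
      (by rw [Subtype.range_val]; exact self_mem_nhdsWithin)]
  refine tendsto_congr fun ε => eLpNorm_congr_ae ?_
  exact ((coeFn_sliceLp hb hf ε).sub hγ.coeFn_toLp).symm

/-- Laplace integrals of the weighted `L²` space have boundary values. -/
theorem exists_isBoundaryValue_laplace (hf : MemLp f 2 (weightMeasure b)) :
    ∃ γ, IsBoundaryValue b (laplace f) γ := by
  obtain ⟨Γ, hΓ⟩ := exists_tendsto_sliceLp hb hf
  refine ⟨Γ, (isBoundaryValue_laplace_iff hb hf (Lp.memLp Γ)).2 ?_⟩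
  rwa [Lp.toLp_coeFn]

/-- The passage to boundary values preserves inner products. -/
theorem integral_conj_boundaryValue (hf : MemLp f 2 (weightMeasure b))
    (hg : MemLp g 2 (weightMeasure b)) {φ γ : ℝ × ℝ × ℝ → ℂ}
    (hφ : IsBoundaryValue b (laplace f) φ) (hγ : IsBoundaryValue b (laplace g) γ) :
    ∫ u, starRingEnd ℂ (φ u) * γ u = ∫ v, starRingEnd ℂ (f v) * g v ∂weightMeasure b := by
  have e : ∀ {α : Type} [MeasurableSpace α] {μ : Measure α} {h k : α → ℂ} (hh : MemLp h 2 μ)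
      (hk : MemLp k 2 μ), inner ℂ (hh.toLp h) (hk.toLp k) =
        ∫ a, starRingEnd ℂ (h a) * k a ∂μ := fun hh hk => by
    rw [L2.inner_def]
    refine integral_congr_ae ?_
    filter_upwards [hh.coeFn_toLp, hk.coeFn_toLp] with a h1 h2
    rw [h1, h2, RCLike.inner_apply, mul_comm]
  rw [← e hφ.1 hγ.1, ← e hf hg]
  have h1 := ((isBoundaryValue_laplace_iff hb hf hφ.1).1 hφ).inner (𝕜 := ℂ)
    ((isBoundaryValue_laplace_iff hb hg hγ.1).1 hγ)
  have h2 := (tendsto_damp hf).inner (𝕜 := ℂ) (tendsto_damp hg)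
  refine tendsto_nhds_unique h1 (h2.congr fun ε => ?_)
  exact (inner_boundaryLaplace hb ⟨_, damp_mem_fibreSpace hb hf ε.2⟩
    ⟨_, damp_mem_fibreSpace hb hg ε.2⟩).symm

/-- Laplace integrals of the weighted `L²` space belong to the Hardy space. -/
theorem memHardy_laplace (hf : MemLp f 2 (weightMeasure b)) : MemHardy b (laplace f) := by
  refine ⟨differentiableOn_laplace hb hf, lt_of_le_of_lt ?_ (memLp_two_iff.1 hf).2⟩
  refine iSup₂_le fun ε hε => ?_
  rw [slice_laplace, lintegral_slice_laplace hb (damp_mem_fibreSpace hb hf hε)]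
  refine lintegral_mono_ae (ae_weight_half.mono fun v hv => ?_)
  gcongr
  exact enorm_le_iff_norm_le.2 (norm_damp_le hε.le hv)

end

/-! ### Local bounds for functions in the Hardy space -/

/-- The sub-mean value inequality for the square of a holomorphic function on a bidisc. -/
lemma enorm_sq_mul_le_lintegral_bidisc {F : ℂ × ℂ → ℂ} {z : ℂ × ℂ} {ρ : ℝ} (hρ : 0 < ρ)
    (hF : DifferentiableOn ℂ F (Metric.ball z.1 ρ ×ˢ Metric.ball z.2 ρ)) :
    ‖F z‖ₑ ^ 2 * ENNReal.ofReal (Real.pi * ρ ^ 2) * ENNReal.ofReal (Real.pi * ρ ^ 2) ≤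
      ∫⁻ w₁ in Metric.ball z.1 ρ, ∫⁻ w₂ in Metric.ball z.2 ρ, ‖F (w₁, w₂)‖ₑ ^ 2 := by
  have h1 := enorm_sq_mul_le_lintegral_ball (f := fun w => F (w, z.2)) (c := z.1) hρ
    (hF.comp (by fun_prop) fun w hw => ⟨hw, Metric.mem_ball_self hρ⟩)
  calc _ ≤ (∫⁻ w₁ in Metric.ball z.1 ρ, ‖F (w₁, z.2)‖ₑ ^ 2) * ENNReal.ofReal (Real.pi * ρ ^ 2) :=
        mul_le_mul_left h1 _
    _ = ∫⁻ w₁ in Metric.ball z.1 ρ, ‖F (w₁, z.2)‖ₑ ^ 2 * ENNReal.ofReal (Real.pi * ρ ^ 2) :=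
        (lintegral_mul_const' _ _ ENNReal.ofReal_ne_top).symm
    _ ≤ _ := by
        refine setLIntegral_mono' Metric.isOpen_ball.measurableSet fun w₁ hw₁ => ?_
        exact enorm_sq_mul_le_lintegral_ball (f := fun w => F (w₁, w)) (c := z.2) hρ
          (hF.comp (by fun_prop) fun w hw => ⟨hw₁, hw⟩)

lemma lintegral_prod_prod_real {f : ℝ × ℝ × ℝ → ENNReal} (hf : Measurable f) :
    ∫⁻ u, f u = ∫⁻ x : ℝ, ∫⁻ y : ℝ, ∫⁻ t : ℝ, f (x, y, t) := by
  rw [Measure.volume_eq_prod, lintegral_prod _ hf.aemeasurable]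
  refine lintegral_congr fun x => ?_
  rw [Measure.volume_eq_prod]
  exact lintegral_prod _ (hf.comp measurable_prodMk_left).aemeasurable

section
variable {b : ℝ → ℝ} (hb : Continuous b) {F : ℂ × ℂ → ℂ}
include hb

/-- The `L²` mass of a function over a box in the tube domain is controlled by the
`L²` norms of its slices. -/
lemma lintegral_box_le {H : ℂ × ℂ → ENNReal} (hH : Measurable H) {C : ENNReal}
    (hC : ∀ ε : ℝ, 0 < ε → ∫⁻ u : ℝ × ℝ × ℝ, H (tubePoint b u.1 u.2.1 u.2.2 ε) ≤ C)
    {A B : Set ℝ} {R : ℝ}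
    (hAB : ∀ x ∈ A, ∀ s ∈ B, 0 < s - b x ∧ s - b x < R) :
    ∫⁻ w₁ : ℂ, ∫⁻ w₂ : ℂ, {w : ℂ × ℂ | w.1.re ∈ A ∧ w.2.im ∈ B}.indicator H (w₁, w₂) ≤
      C * ENNReal.ofReal R := by
  set Q := {w : ℂ × ℂ | w.1.re ∈ A ∧ w.2.im ∈ B}.indicator H with hQ
  have hK : Measurable fun p : (ℝ × ℝ × ℝ) × ℝ =>
      (Set.Ioo 0 R).indicator (fun ε => H (tubePoint b p.1.1 p.1.2.1 p.1.2.2 ε)) p.2 := by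
    have : (fun p : (ℝ × ℝ × ℝ) × ℝ =>
        (Set.Ioo 0 R).indicator (fun ε => H (tubePoint b p.1.1 p.1.2.1 p.1.2.2 ε)) p.2) =
        (Prod.snd ⁻¹' Set.Ioo 0 R).indicator fun p : (ℝ × ℝ × ℝ) × ℝ =>
          H (tubePoint b p.1.1 p.1.2.1 p.1.2.2 p.2) := by
      ext p
      by_cases hp : p.2 ∈ Set.Ioo 0 R
      · rw [Set.indicator_of_mem hp,
          Set.indicator_of_mem (show p ∈ Prod.snd ⁻¹' Set.Ioo 0 R from hp)]
      · rw [Set.indicator_of_notMem hp,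
          Set.indicator_of_notMem (show p ∉ Prod.snd ⁻¹' Set.Ioo 0 R from hp)]
    rw [this]
    refine (hH.comp (Continuous.measurable ?_)).indicator (measurable_snd measurableSet_Ioo)
    simp only [tubePoint, Complex.mk_eq_add_mul_I]
    fun_prop
  calc ∫⁻ w₁ : ℂ, ∫⁻ w₂ : ℂ, Q (w₁, w₂)
      = ∫⁻ p : ℝ × ℝ, ∫⁻ q : ℝ × ℝ, Q (⟨p.1, p.2⟩, ⟨q.1, q.2⟩) := by
        rw [← lintegral_prod_eq_complex]
        refine lintegral_congr fun p => ?_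
        rw [← lintegral_prod_eq_complex fun w₂ => Q (⟨p.1, p.2⟩, w₂)]
    _ ≤ ∫⁻ p : ℝ × ℝ, ∫⁻ t : ℝ, ∫⁻ s : ℝ, Q (⟨p.1, p.2⟩, ⟨t, s⟩) := by
        refine lintegral_mono fun p => ?_
        rw [Measure.volume_eq_prod]
        exact lintegral_prod_le _
    _ = ∫⁻ p : ℝ × ℝ, ∫⁻ t : ℝ, ∫⁻ ε : ℝ, Q (tubePoint b p.1 p.2 t ε) := by
        refine lintegral_congr fun p => lintegral_congr fun t => ?_
        exact (lintegral_add_left_eq_self (fun s => Q (⟨p.1, p.2⟩, ⟨t, s⟩)) (b p.1)).symm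
    _ ≤ ∫⁻ p : ℝ × ℝ, ∫⁻ t : ℝ, ∫⁻ ε : ℝ,
          (Set.Ioo 0 R).indicator (fun ε => H (tubePoint b p.1 p.2 t ε)) ε := by
        refine lintegral_mono fun p => lintegral_mono fun t => lintegral_mono fun ε => ?_
        refine Set.indicator_apply_le' (fun hw => ?_) fun _ => zero_le
        have := hAB _ hw.1 _ hw.2
        simp only [tubePoint, add_sub_cancel_left] at this
        rw [Set.indicator_of_mem (show ε ∈ Set.Ioo 0 R from this)]
    _ ≤ ∫⁻ x : ℝ, ∫⁻ y : ℝ, ∫⁻ t : ℝ, ∫⁻ ε : ℝ,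
          (Set.Ioo 0 R).indicator (fun ε => H (tubePoint b x y t ε)) ε := by
        rw [Measure.volume_eq_prod]
        exact lintegral_prod_le _
    _ = ∫⁻ u : ℝ × ℝ × ℝ, ∫⁻ ε : ℝ,
          (Set.Ioo 0 R).indicator (fun ε => H (tubePoint b u.1 u.2.1 u.2.2 ε)) ε := by
        exact (lintegral_prod_prod_real hK.lintegral_prod_right').symm
    _ = ∫⁻ ε : ℝ, ∫⁻ u : ℝ × ℝ × ℝ,
          (Set.Ioo 0 R).indicator (fun ε => H (tubePoint b u.1 u.2.1 u.2.2 ε)) ε :=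
        lintegral_lintegral_swap hK.aemeasurable
    _ ≤ ∫⁻ ε : ℝ, (Set.Ioo 0 R).indicator (fun _ => C) ε := by
        refine lintegral_mono fun ε => ?_
        by_cases hε : ε ∈ Set.Ioo 0 R
        · simp only [Set.indicator_of_mem hε]
          exact hC ε hε.1
        · simp [Set.indicator_of_notMem hε]
    _ = C * ENNReal.ofReal R := by
        rw [lintegral_indicator measurableSet_Ioo, setLIntegral_const, Real.volume_Ioo, sub_zero]

/-- A function in the Hardy space is bounded near each vertical plane, uniformly in the
variables `Im z₁` and `Re z₂`. -/
theorem exists_local_bound (hF : MemHardy b F) {x₀ s₀ : ℝ} (h₀ : b x₀ < s₀) :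
    ∃ r M : ℝ, 0 < r ∧ ∀ z : ℂ × ℂ, |z.1.re - x₀| ≤ r → |z.2.im - s₀| ≤ r →
      z ∈ tubeDomain b ∧ ‖F z‖ ≤ M := by
  set C := ⨆ ε : ℝ, ⨆ _ : 0 < ε, ∫⁻ u : ℝ × ℝ × ℝ, ‖slice b F ε u‖ₑ ^ 2 with hCdef
  obtain ⟨δ, hδ, hδb⟩ := Metric.continuousAt_iff.1 (hb.continuousAt (x := x₀))
    ((s₀ - b x₀) / 2) (by linarith)
  set ρ := min (δ / 2) ((s₀ - b x₀) / 4) with hρ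
  have hρ0 : 0 < ρ := lt_min (by linarith) (by linarith)
  have hρ1 : ρ ≤ δ / 2 := min_le_left _ _
  have hρ2 : ρ ≤ (s₀ - b x₀) / 4 := min_le_right _ _
  set R := 2 * (s₀ - b x₀) with hR
  set A := Set.Ioo (x₀ - 2 * ρ) (x₀ + 2 * ρ)
  set B := Set.Ioo (s₀ - 2 * ρ) (s₀ + 2 * ρ)
  have hAB : ∀ x ∈ A, ∀ s ∈ B, 0 < s - b x ∧ s - b x < R := fun x hx s hs => by
    have := hδb (x := x) (by rw [Real.dist_eq, abs_lt]; constructor <;> linarith [hx.1, hx.2])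
    rw [Real.dist_eq, abs_lt] at this
    constructor <;> linarith [hs.1, hs.2, this.1, this.2]
  set F' := (tubeDomain b).indicator F with hF'
  have hF'm : Measurable F' := by
    classical
    rw [hF', ← Set.piecewise_eq_indicator]
    exact hF.1.continuousOn.measurable_piecewise continuousOn_const
      (isOpen_tubeDomain hb).measurableSet
  have hH : Measurable fun z => ‖F' z‖ₑ ^ 2 := hF'm.enorm.pow_const 2
  have hCle : ∀ ε : ℝ, 0 < ε → ∫⁻ u : ℝ × ℝ × ℝ, ‖F' (tubePoint b u.1 u.2.1 u.2.2 ε)‖ₑ ^ 2 ≤ C :=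
    fun ε hε => by
      refine le_trans (le_of_eq (lintegral_congr fun u => ?_))
        (le_iSup₂ (f := fun (ε : ℝ) (_ : 0 < ε) => ∫⁻ u : ℝ × ℝ × ℝ, ‖slice b F ε u‖ₑ ^ 2) ε hε)
      rw [hF', Set.indicator_of_mem (by simp [tubeDomain, tubePoint, hε])]
      rfl
  have hbox := lintegral_box_le hb hH hCle hAB
  set K := C * ENNReal.ofReal R
  have hK : K ≠ ⊤ := ENNReal.mul_ne_top hF.2.ne ENNReal.ofReal_ne_top
  set c := ENNReal.ofReal (Real.pi * ρ ^ 2)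
  have hc0 : c ≠ 0 := by
    have := Real.pi_pos
    simp only [c, ne_eq, ENNReal.ofReal_eq_zero, not_le]; positivity
  have hct : c ≠ ⊤ := ENNReal.ofReal_ne_top
  have hM : K / (c * c) ≠ ⊤ := ENNReal.div_ne_top hK (mul_ne_zero hc0 hc0)
  refine ⟨ρ, Real.sqrt (K / (c * c)).toReal, hρ0, fun z hz1 hz2 => ?_⟩
  rw [abs_le] at hz1 hz2
  have hre : ∀ w ∈ Metric.ball z.1 ρ, w.re ∈ A := fun w hw => by
    have := (Complex.abs_re_le_norm (w - z.1)).trans_lt (mem_ball_iff_norm.1 hw)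
    rw [Complex.sub_re, abs_lt] at this
    constructor <;> linarith
  have him : ∀ w ∈ Metric.ball z.2 ρ, w.im ∈ B := fun w hw => by
    have := (Complex.abs_im_le_norm (w - z.2)).trans_lt (mem_ball_iff_norm.1 hw)
    rw [Complex.sub_im, abs_lt] at this
    constructor <;> linarith
  have hmem : ∀ w₁ ∈ Metric.ball z.1 ρ, ∀ w₂ ∈ Metric.ball z.2 ρ, (w₁, w₂) ∈ tubeDomain b :=
    fun w₁ h1 w₂ h2 => sub_pos.1 (hAB _ (hre _ h1) _ (him _ h2)).1
  refine ⟨hmem _ (Metric.mem_ball_self hρ0) _ (Metric.mem_ball_self hρ0), ?_⟩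
  have h1 := enorm_sq_mul_le_lintegral_bidisc (z := z) hρ0
    (hF.1.mono fun w hw => hmem _ hw.1 _ hw.2)
  have h2 : ∫⁻ w₁ in Metric.ball z.1 ρ, ∫⁻ w₂ in Metric.ball z.2 ρ, ‖F (w₁, w₂)‖ₑ ^ 2 ≤ K := by
    refine le_trans ?_ hbox
    refine (setLIntegral_mono' Metric.isOpen_ball.measurableSet fun w₁ h1 => ?_).trans
      (setLIntegral_le_lintegral _ _)
    refine (setLIntegral_mono' Metric.isOpen_ball.measurableSet fun w₂ h2 => ?_).trans
      (setLIntegral_le_lintegral _ _)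
    rw [Set.indicator_of_mem (show (w₁, w₂) ∈ {w : ℂ × ℂ | w.1.re ∈ A ∧ w.2.im ∈ B} from
      ⟨hre _ h1, him _ h2⟩), hF',
      Set.indicator_of_mem (hmem _ h1 _ h2)]
  have h3 : ‖F z‖ₑ ^ 2 ≤ K / (c * c) := by
    rw [ENNReal.le_div_iff_mul_le (Or.inl (mul_ne_zero hc0 hc0))
      (Or.inl (ENNReal.mul_ne_top hct hct)), ← mul_assoc]
    exact h1.trans h2
  refine Real.le_sqrt_of_sq_le ?_
  have := ENNReal.toReal_mono hM h3
  simpa using this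

end

/-! ### Holomorphic functions with Gaussian decay on fibres -/

/-- The point of `ℂ²` with `Re z₁ = x`, `Im z₂ = s` and vanishing `Im z₁`, `Re z₂`. -/
def axisPoint (x s : ℝ) : ℂ × ℂ := (⟨x, 0⟩, ⟨0, s⟩)

/-- The restriction of `F` to the real plane `Re z₁ = x`, `Im z₂ = s`, with the complex coordinate
`w = Im z₁ + i Re z₂`. -/
def fibre (F : ℂ × ℂ → ℂ) (x s : ℝ) (w : ℂ) : ℂ := F (⟨x, w.re⟩, ⟨w.im, s⟩)

/-- Gaussian decay along the fibres, locally uniformly in the base of the tube domain. -/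
def HasGaussianBound (b : ℝ → ℝ) (δ : ℝ) (Φ : ℂ × ℂ → ℂ) : Prop :=
  ∀ x₀ s₀ : ℝ, b x₀ < s₀ → ∃ r M : ℝ, 0 < r ∧ 0 ≤ M ∧ ∀ x s y t : ℝ, |x - x₀| ≤ r → |s - s₀| ≤ r →
    ((⟨x, y⟩, ⟨t, s⟩) : ℂ × ℂ) ∈ tubeDomain b ∧
      ‖Φ (⟨x, y⟩, ⟨t, s⟩)‖ ≤ M * (Real.exp (-δ * y ^ 2) * Real.exp (-δ * t ^ 2))

lemma integrable_gaussian_prod {δ : ℝ} (hδ : 0 < δ) :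
    Integrable fun w : ℂ => Real.exp (-δ * w.re ^ 2) * Real.exp (-δ * w.im ^ 2) := by
  have h := (integrable_exp_neg_mul_sq hδ).mul_prod (integrable_exp_neg_mul_sq hδ)
  rw [← Measure.volume_eq_prod] at h
  exact Complex.volume_preserving_equiv_real_prod.integrable_comp_of_integrable h

lemma tendsto_gaussian_atTop {δ : ℝ} (hδ : 0 < δ) (C : ℝ) :
    Tendsto (fun y : ℝ => C * Real.exp (-δ * y ^ 2)) atTop (𝓝 0) := by
  have h : Tendsto (fun y : ℝ => -δ * y ^ 2) atTop atBot :=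
    (tendsto_pow_atTop two_ne_zero).const_mul_atTop_of_neg (neg_lt_zero.2 hδ)
  simpa using (Real.tendsto_exp_atBot.comp h).const_mul C

lemma tendsto_gaussian_atBot {δ : ℝ} (hδ : 0 < δ) (C : ℝ) :
    Tendsto (fun y : ℝ => C * Real.exp (-δ * y ^ 2)) atBot (𝓝 0) := by
  refine ((tendsto_gaussian_atTop hδ C).comp tendsto_neg_atBot_atTop).congr fun y => ?_
  simp

lemma memLp_two_of_integrable_of_bound {f : ℂ → ℂ} (hf : Integrable f) {C : ℝ}
    (hC : ∀ w, ‖f w‖ ≤ C) : MemLp f 2 := by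
  refine memLp_two_iff.2 ⟨hf.1, ?_⟩
  calc ∫⁻ w, ‖f w‖ₑ ^ 2 ≤ ∫⁻ w, ENNReal.ofReal C * ‖f w‖ₑ := by
        refine lintegral_mono fun w => ?_
        rw [sq]
        gcongr
        rw [← ofReal_norm]
        exact ENNReal.ofReal_le_ofReal (hC w)
    _ = ENNReal.ofReal C * ∫⁻ w, ‖f w‖ₑ := lintegral_const_mul' _ _ ENNReal.ofReal_ne_top
    _ < ⊤ := ENNReal.mul_lt_top ENNReal.ofReal_lt_top hf.2

section
variable {b : ℝ → ℝ} {δ : ℝ} {Φ : ℂ × ℂ → ℂ}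

lemma continuous_fibre (hΦ : ContinuousOn Φ (tubeDomain b)) {x s : ℝ}
    (h : b x < s) : Continuous (fibre Φ x s) :=
  hΦ.comp_continuous (by simp only [Complex.mk_eq_add_mul_I]; fun_prop) fun _ => h

lemma HasGaussianBound.integrable_fibre (hδ : 0 < δ)
    (hΦ : ContinuousOn Φ (tubeDomain b)) (hB : HasGaussianBound b δ Φ) {x s : ℝ} (h : b x < s) :
    Integrable (fibre Φ x s) := by
  obtain ⟨r, M, hr, hM, hB⟩ := hB x s h
  refine ((integrable_gaussian_prod hδ).const_mul M).mono'
    (continuous_fibre hΦ h).aestronglyMeasurable (ae_of_all _ fun w => ?_)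
  exact (hB x s w.re w.im (by simp [hr.le]) (by simp [hr.le])).2

lemma HasGaussianBound.memLp_fibre (hδ : 0 < δ)
    (hΦ : ContinuousOn Φ (tubeDomain b)) (hB : HasGaussianBound b δ Φ) {x s : ℝ} (h : b x < s) :
    MemLp (fibre Φ x s) 2 := by
  have hi := hB.integrable_fibre hδ hΦ h
  obtain ⟨r, M, hr, hM, hB⟩ := hB x s h
  refine memLp_two_of_integrable_of_bound hi (C := M) fun w => ?_
  refine (hB x s w.re w.im (by simp [hr.le]) (by simp [hr.le])).2.trans ?_
  refine mul_le_of_le_one_right hM (mul_le_one₀ ?_ (Real.exp_pos _).le ?_) <;>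
  · apply Real.exp_le_one_iff.2
    nlinarith [sq_nonneg w.re, sq_nonneg w.im]

lemma integral_complex_eq_re_im {E : Type*} [NormedAddCommGroup E] [NormedSpace ℝ E] {f : ℂ → E}
    (hf : Integrable f) : ∫ w, f w = ∫ y : ℝ, ∫ t : ℝ, f ⟨y, t⟩ := by
  have hp := Complex.volume_preserving_equiv_real_prod.symm
  have he := Complex.measurableEquivRealProd.symm.measurableEmbedding
  rw [← hp.integral_comp he, Measure.volume_eq_prod, integral_prod]
  · rfl
  · rw [← Measure.volume_eq_prod]; exact (hp.integrable_comp_emb he).2 hf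

lemma integral_complex_eq_im_re {E : Type*} [NormedAddCommGroup E] [NormedSpace ℝ E] {f : ℂ → E}
    (hf : Integrable f) : ∫ w, f w = ∫ t : ℝ, ∫ y : ℝ, f ⟨y, t⟩ := by
  have hp := Complex.volume_preserving_equiv_real_prod.symm
  have he := Complex.measurableEquivRealProd.symm.measurableEmbedding
  rw [← hp.integral_comp he, Measure.volume_eq_prod, integral_prod_symm]
  · rfl
  · rw [← Measure.volume_eq_prod]; exact (hp.integrable_comp_emb he).2 hf

/-- Integrals over the fibres do not depend on the fibre: by Cauchy's theorem in each
variable they are locally constant. -/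
theorem HasGaussianBound.integral_fibre_eq (hb : Continuous b) (hδ : 0 < δ)
    (hΦ : DifferentiableOn ℂ Φ (tubeDomain b)) (hB : HasGaussianBound b δ Φ) {x s x' s' : ℝ}
    (h : b x < s) (h' : b x' < s') : ∫ w, fibre Φ x s w = ∫ w, fibre Φ x' s' w := by
  have hopen := isOpen_tubeDomain hb
  have hloc : ∀ x₀ s₀ : ℝ, b x₀ < s₀ → ∃ r > 0, ∀ x s : ℝ, |x - x₀| ≤ r → |s - s₀| ≤ r →
      ∫ w, fibre Φ x s w = ∫ w, fibre Φ x₀ s₀ w := fun x₀ s₀ h₀ => by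
    obtain ⟨r, M, hr, hM, hBr⟩ := hB x₀ s₀ h₀
    have hs0 : |s₀ - s₀| ≤ r := by simp [hr.le]
    have hx0 : |x₀ - x₀| ≤ r := by simp [hr.le]
    have hsub : ∀ a c : ℝ, |c - a| ≤ r → ∀ u ∈ Set.uIcc a c, |u - a| ≤ r := fun a c hc u hu =>
      (Set.abs_sub_left_of_mem_uIcc hu).trans hc
    refine ⟨r, hr, fun x s hx hs => ?_⟩
    have hxs : b x < s := (hBr x s 0 0 hx hs).1
    have hx0s : b x₀ < s := (hBr x₀ s 0 0 hx0 hs).1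
    have e1 : ∫ w, fibre Φ x s w = ∫ w, fibre Φ x₀ s w := by
      rw [integral_complex_eq_im_re (hB.integrable_fibre hδ hΦ.continuousOn hxs),
        integral_complex_eq_im_re (hB.integrable_fibre hδ hΦ.continuousOn hx0s)]
      congr 1; ext t
      refine (integral_vertical_eq (f := fun z => Φ (z, ⟨t, s⟩)) (a := x₀) (b := x)
        (B := fun y => (M * Real.exp (-δ * t ^ 2)) * Real.exp (-δ * y ^ 2)) (fun z hz => ?_)
        (fun u hu y => ?_) ((integrable_exp_neg_mul_sq hδ).const_mul _)
        (tendsto_gaussian_atTop hδ _) (tendsto_gaussian_atBot hδ _)).symm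
      · have hm : (z, (⟨t, s⟩ : ℂ)) ∈ tubeDomain b :=
          (hBr z.re s z.im t (hsub _ _ hx _ hz) hs).1
        exact ((hΦ _ hm).differentiableAt (hopen.mem_nhds hm)).comp z
          (by fun_prop : DifferentiableAt ℂ (fun z : ℂ => (z, (⟨t, s⟩ : ℂ))) z)
      · refine (hBr u s y t (hsub _ _ hx _ hu) hs).2.trans (le_of_eq ?_)
        ring
    have e2 : ∫ w, fibre Φ x₀ s w = ∫ w, fibre Φ x₀ s₀ w := by
      rw [integral_complex_eq_re_im (hB.integrable_fibre hδ hΦ.continuousOn hx0s),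
        integral_complex_eq_re_im (hB.integrable_fibre hδ hΦ.continuousOn h₀)]
      congr 1; ext y
      refine (integral_horizontal_eq (f := fun z => Φ (⟨x₀, y⟩, z)) (a := s₀) (b := s)
        (B := fun t => (M * Real.exp (-δ * y ^ 2)) * Real.exp (-δ * t ^ 2)) (fun z hz => ?_)
        (fun u hu t => ?_) ((integrable_exp_neg_mul_sq hδ).const_mul _)
        (tendsto_gaussian_atTop hδ _) (tendsto_gaussian_atBot hδ _)).symm
      · have hm : ((⟨x₀, y⟩ : ℂ), z) ∈ tubeDomain b :=
          (hBr x₀ z.im y z.re hx0 (hsub _ _ hs _ hz)).1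
        exact ((hΦ _ hm).differentiableAt (hopen.mem_nhds hm)).comp z
          (by fun_prop : DifferentiableAt ℂ (fun z : ℂ => ((⟨x₀, y⟩ : ℂ), z)) z)
      · refine (hBr x₀ u y t hx0 (hsub _ _ hs _ hu)).2.trans (le_of_eq ?_)
        ring
    rw [e1, e2]
  -- In the coordinates `(x, log (s - b x))` the base of the tube domain is the whole plane.
  let J : ℝ × ℝ → ℂ := fun p => ∫ w, fibre Φ p.1 (b p.1 + Real.exp p.2) w
  have hJ : IsLocallyConstant J := by
    refine (IsLocallyConstant.iff_eventually_eq J).2 fun p => ?_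
    obtain ⟨r, hr, hloc⟩ := hloc p.1 (b p.1 + Real.exp p.2) (by simp [Real.exp_pos])
    have c1 : ContinuousAt (fun q : ℝ × ℝ => |q.1 - p.1|) p := by fun_prop
    have c2 : ContinuousAt
      (fun q : ℝ × ℝ => |b q.1 + Real.exp q.2 - (b p.1 + Real.exp p.2)|) p := by fun_prop
    have hr1 : |p.1 - p.1| < r := by simpa using hr
    have hr2 : |b p.1 + Real.exp p.2 - (b p.1 + Real.exp p.2)| < r := by simpa using hr
    filter_upwards [c1.eventually_lt_const hr1, c2.eventually_lt_const hr2] with q h1 h2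
    exact hloc _ _ h1.le h2.le
  have := hJ.apply_eq_of_preconnectedSpace (x, Real.log (s - b x)) (x', Real.log (s' - b x'))
  simp only [J] at this
  rwa [Real.exp_log (sub_pos.2 h), Real.exp_log (sub_pos.2 h'), add_sub_cancel,
    add_sub_cancel] at this

lemma HasGaussianBound.mul_exp (hB : HasGaussianBound b δ Φ) (v : ℂ) :
    HasGaussianBound b δ fun z => Φ z * Complex.exp (-freqForm v z) := fun x₀ s₀ h₀ => by
  obtain ⟨r, M, hr, hM, hB⟩ := hB x₀ s₀ h₀
  set E := Real.exp (2 * Real.pi * (|v.re| * (|x₀| + r) + |v.im| * (|s₀| + r)))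
  refine ⟨r, M * E, hr, by positivity, fun x s y t hx hs => ⟨(hB x s y t hx hs).1, ?_⟩⟩
  have hE : ‖Complex.exp (-freqForm v (⟨x, y⟩, ⟨t, s⟩))‖ ≤ E := by
    rw [Complex.norm_exp, Complex.neg_re, freqForm_re]
    apply Real.exp_le_exp.2
    rw [← mul_neg]
    refine mul_le_mul_of_nonneg_left ?_ (by positivity)
    have h1 : |x| ≤ |x₀| + r := by linarith [abs_sub_abs_le_abs_sub x x₀]
    have h2 : |s| ≤ |s₀| + r := by linarith [abs_sub_abs_le_abs_sub s s₀]
    calc -(v.re * x - v.im * s) ≤ |v.re * x| + |v.im * s| := by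
          linarith [neg_abs_le (v.re * x), le_abs_self (v.im * s)]
      _ ≤ _ := by rw [abs_mul, abs_mul]; gcongr
  rw [norm_mul]
  calc _ ≤ (M * (Real.exp (-δ * y ^ 2) * Real.exp (-δ * t ^ 2))) * E :=
        mul_le_mul (hB x s y t hx hs).2 hE (norm_nonneg _) (by positivity)
    _ = _ := by ring

/-- The Fourier–Laplace coefficient of `Φ` at the frequency `v`, computed on a fibre. -/
def coeff (Φ : ℂ × ℂ → ℂ) (x s : ℝ) (v : ℂ) : ℂ :=
  ∫ w, fibre (fun z => Φ z * Complex.exp (-freqForm v z)) x s w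

lemma freqForm_fibre (v : ℂ) (x s : ℝ) (w : ℂ) :
    freqForm v (⟨x, w.re⟩, ⟨w.im, s⟩) = freqForm v (axisPoint x s) +
      (2 * Real.pi * inner ℝ w v : ℝ) * Complex.I := by
  have e : inner ℝ w v = v.re * w.re + v.im * w.im := by
    simp [Complex.inner]
  rw [e]
  simp only [freqForm_apply, axisPoint, Complex.mk_eq_add_mul_I]
  push_cast
  ring

lemma fourier_fibre_eq_mul_coeff (Φ : ℂ × ℂ → ℂ) (x s : ℝ) (v : ℂ) :
    𝓕 (fibre Φ x s) v = Complex.exp (freqForm v (axisPoint x s)) * coeff Φ x s v := by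
  rw [Real.fourier_eq', coeff, ← integral_const_mul]
  refine integral_congr_ae (ae_of_all _ fun w => ?_)
  simp only [fibre, freqForm_fibre, smul_eq_mul]
  rw [mul_left_comm, ← Complex.exp_add, mul_comm]
  congr 2
  push_cast
  ring

variable (hb : Continuous b) (hδ : 0 < δ) (hΦ : DifferentiableOn ℂ Φ (tubeDomain b))
  (hB : HasGaussianBound b δ Φ)
include hb hδ hΦ hB

lemma HasGaussianBound.coeff_eq {x s x' s' : ℝ} (h : b x < s) (h' : b x' < s') :
    coeff Φ x s = coeff Φ x' s' := by
  ext v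
  refine (hB.mul_exp v).integral_fibre_eq hb hδ (hΦ.mul ?_) h h'
  exact (freqForm v).differentiable.neg.cexp.differentiableOn

omit hb in
lemma HasGaussianBound.continuous_coeff {x s : ℝ} (h : b x < s) : Continuous (coeff Φ x s) := by
  have e : coeff Φ x s =
      fun v => Complex.exp (-freqForm v (axisPoint x s)) * 𝓕 (fibre Φ x s) v := by
    ext v
    rw [fourier_fibre_eq_mul_coeff, ← mul_assoc, ← Complex.exp_add]
    simp
  rw [e]
  refine (continuous_freqForm_apply _).neg.cexp.mul ?_
  exact VectorFourier.fourierIntegral_continuous Real.continuous_fourierChar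
      (innerSL ℝ).continuous₂ (hB.integrable_fibre hδ hΦ.continuousOn h)

/-- Moving the fibre in all directions shows that the Fourier transform on a fibre decays
exponentially. -/
lemma HasGaussianBound.exists_norm_fourier_le {x₀ s₀ : ℝ} (h : b x₀ < s₀) :
    ∃ C c : ℝ, 0 < c ∧ ∀ v : ℂ, ‖Complex.exp (freqForm v (axisPoint x₀ s₀)) * coeff Φ x₀ s₀ v‖ ≤
      C * Real.exp (-(c * (|v.re| + |v.im|))) := by
  obtain ⟨r, M, hr, hM, hBr⟩ := hB x₀ s₀ h
  set G := ∫ w : ℂ, Real.exp (-δ * w.re ^ 2) * Real.exp (-δ * w.im ^ 2)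
  have hbox : ∀ x s : ℝ, |x - x₀| ≤ r → |s - s₀| ≤ r → ∀ v,
      ‖Complex.exp (freqForm v (axisPoint x s)) * coeff Φ x₀ s₀ v‖ ≤ M * G :=
    fun x s hx hs v => by
      have hxs : b x < s := (hBr x s 0 0 hx hs).1
      rw [hB.coeff_eq hb hδ hΦ h hxs, ← fourier_fibre_eq_mul_coeff]
      calc ‖𝓕 (fibre Φ x s) v‖ ≤ ∫ w, ‖fibre Φ x s w‖ :=
            VectorFourier.norm_fourierIntegral_le_integral_norm _ _ _ _ _
        _ ≤ ∫ w : ℂ, M * (Real.exp (-δ * w.re ^ 2) * Real.exp (-δ * w.im ^ 2)) :=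
            integral_mono (hB.integrable_fibre hδ hΦ.continuousOn hxs).norm
              ((integrable_gaussian_prod hδ).const_mul M) fun w => (hBr x s w.re w.im hx hs).2
        _ = M * G := integral_const_mul _ _
  have hsign : ∀ a : ℝ, ∃ σ : ℝ, |σ| ≤ 1 ∧ a * σ = |a| := fun a => by
    rcases le_total 0 a with ha | ha
    · exact ⟨1, by simp, by rw [abs_of_nonneg ha, mul_one]⟩
    · exact ⟨-1, by simp, by rw [abs_of_nonpos ha]; ring⟩
  refine ⟨M * G, 2 * Real.pi * r, by have := Real.pi_pos; positivity, fun v => ?_⟩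
  obtain ⟨σ, hσ, hσv⟩ := hsign v.re
  obtain ⟨σ', hσ', hσv'⟩ := hsign v.im
  have h1 : |x₀ + r * σ - x₀| ≤ r := by
    rw [add_sub_cancel_left, abs_mul, abs_of_pos hr]
    exact mul_le_of_le_one_right hr.le hσ
  have h2 : |s₀ - r * σ' - s₀| ≤ r := by
    rw [sub_sub_cancel_left, abs_neg, abs_mul, abs_of_pos hr]
    exact mul_le_of_le_one_right hr.le hσ'
  have key := hbox _ _ h1 h2 v
  rw [norm_mul, Complex.norm_exp, freqForm_re] at key ⊢
  simp only [axisPoint] at key ⊢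
  have e : 2 * Real.pi * (v.re * x₀ - v.im * s₀) =
      2 * Real.pi * (v.re * (x₀ + r * σ) - v.im * (s₀ - r * σ')) +
        -(2 * Real.pi * r * (|v.re| + |v.im|)) := by
    rw [← hσv, ← hσv']; ring
  rw [e, Real.exp_add, mul_right_comm]
  exact mul_le_mul_of_nonneg_right key (Real.exp_pos _).le

lemma HasGaussianBound.integrable_exp_mul_coeff {x s : ℝ} (h : b x < s) :
    Integrable (fun v => Complex.exp (freqForm v (axisPoint x s)) * coeff Φ x s v) ∧
      MemLp (fun v => Complex.exp (freqForm v (axisPoint x s)) * coeff Φ x s v) 2 := by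
  obtain ⟨C, c, hc, hC⟩ := hB.exists_norm_fourier_le hb hδ hΦ h
  have hi : Integrable (fun v => Complex.exp (freqForm v (axisPoint x s)) * coeff Φ x s v) :=
    ((integrable_exp_neg_abs_add hc).const_mul C).mono'
      ((continuous_freqForm_apply _).cexp.mul
        (hB.continuous_coeff hδ hΦ h)).aestronglyMeasurable (ae_of_all _ hC)
  refine ⟨hi, memLp_two_of_integrable_of_bound hi (C := |C|) fun v => (hC v).trans ?_⟩
  refine (mul_le_mul_of_nonneg_right (le_abs_self C) (Real.exp_pos _).le).trans
    (mul_le_of_le_one_right (abs_nonneg C) (Real.exp_le_one_iff.2 ?_))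
  have : 0 ≤ c * (|v.re| + |v.im|) := by positivity
  linarith

/-- The `L²` Fourier transform of a fibre in terms of the Fourier–Laplace coefficients. -/
lemma HasGaussianBound.toLp_exp_mul_coeff {x s : ℝ} (h : b x < s) :
    (hB.integrable_exp_mul_coeff hb hδ hΦ h).2.toLp _ =
      𝓕 ((hB.memLp_fibre hδ hΦ.continuousOn h).toLp (fibre Φ x s)) := by
  obtain ⟨h1, h2⟩ := hB.integrable_exp_mul_coeff hb hδ hΦ h
  have hinv : 𝓕⁻ (fun v => Complex.exp (freqForm v (axisPoint x s)) * coeff Φ x s v) =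
      fibre Φ x s := by
    have e : (fun v => Complex.exp (freqForm v (axisPoint x s)) * coeff Φ x s v) =
        𝓕 (fibre Φ x s) := by
      ext v; rw [fourier_fibre_eq_mul_coeff]
    rw [e] at h1 ⊢
    exact (continuous_fibre hΦ.continuousOn h).fourierInv_fourier_eq
      (hB.integrable_fibre hδ hΦ.continuousOn h) h1
  have key : 𝓕⁻ (h2.toLp _) = (hB.memLp_fibre hδ hΦ.continuousOn h).toLp (fibre Φ x s) := by
    refine Lp.ext ((coeFn_fourierInv_toLp h1 h2).trans ?_)
    rw [hinv]
    exact (MemLp.coeFn_toLp _).symm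
  rw [← key, FourierTransform.fourier_fourierInv_eq]

end

/-! ### The Paley–Wiener theorem for the Hardy space -/

/-- `F` multiplied by `exp (δ (z₁² - z₂²))`, which decays in `Im z₁` and `Re z₂`. -/
def gaussDamp (δ : ℝ) (F : ℂ × ℂ → ℂ) (z : ℂ × ℂ) : ℂ :=
  F z * Complex.exp (δ * (z.1 ^ 2 - z.2 ^ 2))

lemma norm_exp_gauss (δ x s y t : ℝ) :
    ‖Complex.exp (δ * ((⟨x, y⟩ : ℂ) ^ 2 - (⟨t, s⟩ : ℂ) ^ 2))‖ =
      Real.exp (δ * (x ^ 2 + s ^ 2)) * (Real.exp (-δ * y ^ 2) * Real.exp (-δ * t ^ 2)) := by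
  rw [Complex.norm_exp, ← Real.exp_add, ← Real.exp_add]
  congr 1
  simp [sq]
  ring

section
variable {b : ℝ → ℝ} (hb : Continuous b) {F : ℂ × ℂ → ℂ} (hF : MemHardy b F)
include hb hF

lemma hasGaussianBound_gaussDamp {δ : ℝ} (hδ : 0 < δ) : HasGaussianBound b δ (gaussDamp δ F) :=
  fun x₀ s₀ h₀ => by
    obtain ⟨r, M, hr, hM⟩ := exists_local_bound hb hF h₀
    refine ⟨r, |M| * Real.exp (δ * ((|x₀| + r) ^ 2 + (|s₀| + r) ^ 2)), hr, by positivity,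
      fun x s y t hx hs => ⟨(hM (⟨x, y⟩, ⟨t, s⟩) hx hs).1, ?_⟩⟩
    rw [gaussDamp, norm_mul, norm_exp_gauss, ← mul_assoc]
    have h1 : |x| ≤ |x₀| + r := by linarith [abs_sub_abs_le_abs_sub x x₀]
    have h2 : |s| ≤ |s₀| + r := by linarith [abs_sub_abs_le_abs_sub s s₀]
    have h1' : x ^ 2 ≤ (|x₀| + r) ^ 2 :=
      sq_le_sq' (by linarith [neg_abs_le x]) (by linarith [le_abs_self x])
    have h2' : s ^ 2 ≤ (|s₀| + r) ^ 2 :=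
      sq_le_sq' (by linarith [neg_abs_le s]) (by linarith [le_abs_self s])
    gcongr
    exact ((hM (⟨x, y⟩, ⟨t, s⟩) hx hs).2).trans (le_abs_self M)

omit hb in
lemma differentiableOn_gaussDamp (δ : ℝ) : DifferentiableOn ℂ (gaussDamp δ F) (tubeDomain b) :=
  hF.1.mul (by fun_prop)

lemma continuous_slice {ε : ℝ} (hε : 0 < ε) : Continuous (slice b F ε) :=
  hF.1.continuousOn.comp_continuous (continuous_tubePoint hb ε)
    fun _ => by simp [tubeDomain, tubePoint, hε]

/-- On each slice, almost every fibre is square integrable. -/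
lemma ae_memLp_fibre {ε : ℝ} (hε : 0 < ε) : ∀ᵐ x : ℝ, MemLp (fibre F x (b x + ε)) 2 := by
  have hfin : ∫⁻ u, ‖slice b F ε u‖ₑ ^ 2 < ⊤ :=
    (le_iSup₂ (f := fun (ε : ℝ) (_ : 0 < ε) => ∫⁻ u : ℝ × ℝ × ℝ, ‖slice b F ε u‖ₑ ^ 2)
      ε hε).trans_lt hF.2
  have hm : Measurable fun u => ‖slice b F ε u‖ₑ ^ 2 :=
    ((continuous_slice hb hF hε).measurable.enorm).pow_const 2
  rw [Measure.volume_eq_prod, lintegral_prod _ hm.aemeasurable] at hfin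
  filter_upwards [ae_lt_top hm.lintegral_prod_right' hfin.ne] with x hx
  refine memLp_two_iff.2 ⟨(continuous_fibre hF.1.continuousOn
    (by linarith)).aestronglyMeasurable, ?_⟩
  rw [← lintegral_prod_eq_complex fun w => ‖fibre F x (b x + ε) w‖ₑ ^ 2]
  exact hx

lemma tendsto_toLp_fibre_gaussDamp {x s : ℝ} (h : b x < s) (hL : MemLp (fibre F x s) 2)
    {δ : ℕ → ℝ} (hδ : ∀ n, 0 < δ n) (hδ1 : ∀ n, δ n ≤ 1) (hδ0 : Tendsto δ atTop (𝓝 0)) :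
    Tendsto (fun n => ((hasGaussianBound_gaussDamp hb hF (hδ n)).memLp_fibre (hδ n)
      (differentiableOn_gaussDamp hF (δ n)).continuousOn h).toLp (fibre (gaussDamp (δ n) F) x s))
      atTop (𝓝 (hL.toLp _)) := by
  rw [Lp.tendsto_Lp_iff_tendsto_eLpNorm'']
  refine ENNReal.tendsto_zero_of_sq ?_
  simp only [eLpNorm_two_sq, Pi.sub_apply]
  have : (0 : ENNReal) = ∫⁻ _ : ℂ, (0:ENNReal) := by simp
  rw [this]
  set K := Real.exp (x ^ 2 + s ^ 2) + 1
  refine tendsto_lintegral_filter_of_dominated_convergence'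
    (fun w => (ENNReal.ofReal K * ‖fibre F x s w‖ₑ) ^ 2)
    (Eventually.of_forall fun n => ?_) (Eventually.of_forall fun n => ae_of_all _ fun w => ?_) ?_
    (ae_of_all _ fun w => ?_)
  · exact (((continuous_fibre (differentiableOn_gaussDamp hF (δ n)).continuousOn
      h).aestronglyMeasurable).sub hL.1).enorm.pow_const 2
  · gcongr
    have e : fibre (gaussDamp (δ n) F) x s w - fibre F x s w =
        (Complex.exp (δ n * ((⟨x, w.re⟩ : ℂ) ^ 2 - (⟨w.im, s⟩ : ℂ) ^ 2)) - 1) * fibre F x s w := by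
      simp only [fibre, gaussDamp]; ring
    rw [e, enorm_mul]
    gcongr
    rw [← ofReal_norm]
    refine ENNReal.ofReal_le_ofReal ((norm_sub_le _ _).trans ?_)
    rw [norm_one, norm_exp_gauss]
    refine add_le_add_left ?_ 1
    have g1 : Real.exp (-δ n * w.re ^ 2) ≤ 1 :=
      Real.exp_le_one_iff.2 (by nlinarith [hδ n, sq_nonneg w.re])
    have g2 : Real.exp (-δ n * w.im ^ 2) ≤ 1 :=
      Real.exp_le_one_iff.2 (by nlinarith [hδ n, sq_nonneg w.im])
    refine (mul_le_of_le_one_right (Real.exp_pos _).le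
      (mul_le_one₀ g1 (Real.exp_pos _).le g2)).trans (Real.exp_le_exp.2 ?_)
    nlinarith [hδ1 n, sq_nonneg x, sq_nonneg s]
  · simp only [mul_pow]
    rw [lintegral_const_mul' _ _ (by finiteness)]
    exact ENNReal.mul_ne_top (by finiteness) (memLp_two_iff.1 hL).2.ne
  · have hc : Continuous fun d : ℝ => ‖fibre (gaussDamp d F) x s w - fibre F x s w‖ₑ ^ 2 := by
      unfold fibre gaussDamp; fun_prop
    have := (hc.tendsto 0).comp hδ0
    simpa [Function.comp_def, fibre, gaussDamp] using this

/-- All square integrable fibres of a function in the Hardy space have the same Fourier–Laplace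
coefficients. -/
theorem exists_fourier_toLp_fibre : ∃ g : ℂ → ℂ, Measurable g ∧ ∀ x s : ℝ, b x < s →
    ∀ hL : MemLp (fibre F x s) 2,
      (𝓕 (hL.toLp (fibre F x s)) : Lp ℂ 2 (volume : Measure ℂ)) =ᵐ[volume]
        fun v => Complex.exp (freqForm v (axisPoint x s)) * g v := by
  obtain ⟨x₀, hL₀⟩ := (ae_memLp_fibre hb hF one_pos).exists
  set s₀ := b x₀ + 1
  have h₀ : b x₀ < s₀ := by simp [s₀]
  let δ : ℕ → ℝ := fun n => 1 / ((n : ℝ) + 1)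
  have hδ : ∀ n, 0 < δ n := fun n => Nat.one_div_pos_of_nat
  have hδ1 : ∀ n, δ n ≤ 1 := fun n => by
    refine div_le_one_of_le₀ ?_ (by positivity)
    linarith [(Nat.cast_nonneg n : (0:ℝ) ≤ n)]
  have hδ0 : Tendsto δ atTop (𝓝 0) := tendsto_one_div_add_atTop_nhds_zero_nat
  have hB := fun n => hasGaussianBound_gaussDamp hb hF (hδ n)
  have hd := fun n => differentiableOn_gaussDamp hF (δ n)
  set c : ℕ → ℂ → ℂ := fun n => coeff (gaussDamp (δ n) F) x₀ s₀ with hc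
  -- `L²` convergence on every good fibre, in terms of the common coefficients `c n`.
  have hconv : ∀ x s : ℝ, b x < s → ∀ hL : MemLp (fibre F x s) 2, ∀ ψ : ℕ → ℕ,
      Tendsto ψ atTop atTop → ∃ ns : ℕ → ℕ, StrictMono ns ∧ ∀ᵐ v : ℂ,
        Tendsto (fun k => Complex.exp (freqForm v (axisPoint x s)) * c (ψ (ns k)) v) atTop
          (𝓝 ((𝓕 (hL.toLp (fibre F x s)) : Lp ℂ 2 (volume : Measure ℂ)) v)) :=
    fun x s h hL ψ hψ => by
      have h1 := ((Lp.fourierTransformₗᵢ ℂ ℂ).continuous.tendsto _).comp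
        ((tendsto_toLp_fibre_gaussDamp hb hF h hL hδ hδ1 hδ0).comp hψ)
      have h2 : Tendsto (fun k => ((hB (ψ k)).integrable_exp_mul_coeff hb (hδ (ψ k))
          (hd (ψ k)) h).2.toLp _) atTop
          (𝓝 (𝓕 (hL.toLp (fibre F x s)) : Lp ℂ 2 (volume : Measure ℂ))) :=
        h1.congr fun k => ((hB (ψ k)).toLp_exp_mul_coeff hb (hδ (ψ k)) (hd (ψ k)) h).symm
      obtain ⟨ns, hns, hae⟩ := (tendstoInMeasure_of_tendsto_Lp h2).exists_seq_tendsto_ae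
      refine ⟨ns, hns, ?_⟩
      have hall : ∀ᵐ v : ℂ, ∀ k, (((hB (ψ k)).integrable_exp_mul_coeff hb (hδ (ψ k))
          (hd (ψ k)) h).2.toLp _ : ℂ → ℂ) v =
          Complex.exp (freqForm v (axisPoint x s)) * coeff (gaussDamp (δ (ψ k)) F) x s v :=
        ae_all_iff.2 fun k => MemLp.coeFn_toLp _
      filter_upwards [hae, hall] with v hv hv'
      refine hv.congr fun k => ?_
      rw [hv', hc, (hB _).coeff_eq hb (hδ _) (hd _) h h₀]
  obtain ⟨ns, hns, hae⟩ := hconv x₀ s₀ h₀ hL₀ id tendsto_id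
  set G := (𝓕 (hL₀.toLp (fibre F x₀ s₀)) : Lp ℂ 2 (volume : Measure ℂ))
  have hlim : ∀ᵐ v : ℂ, Tendsto (fun k => c (ns k) v) atTop
      (𝓝 (Complex.exp (-freqForm v (axisPoint x₀ s₀)) * G v)) := by
    filter_upwards [hae] with v hv
    refine (hv.const_mul (Complex.exp (-freqForm v (axisPoint x₀ s₀)))).congr fun k => ?_
    rw [← mul_assoc, ← Complex.exp_add]
    simp
  refine ⟨fun v => Complex.exp (-freqForm v (axisPoint x₀ s₀)) * G v,
    (continuous_freqForm_apply _).neg.cexp.measurable.mul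
      (Lp.stronglyMeasurable G).measurable, fun x s h hL => ?_⟩
  obtain ⟨ms, hms, hae'⟩ := hconv x s h hL ns hns.tendsto_atTop
  filter_upwards [hlim, hae'] with v hv hv'
  exact tendsto_nhds_unique hv' ((hv.comp hms.tendsto_atTop).const_mul _)

/-- The **Paley–Wiener theorem** for the Hardy space: each function in it is the Laplace integral
of a function in the weighted `L²` space. -/
theorem exists_eq_laplace (hN : ∀ v : ℂ, v.im < 0 → weight b v = ⊤) :
    ∃ f, MemLp f 2 (weightMeasure b) ∧ ∀ z ∈ tubeDomain b, F z = laplace f z := by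
  obtain ⟨g, hg, hfour⟩ := exists_fourier_toLp_fibre hb hF
  set C := ⨆ ε : ℝ, ⨆ _ : 0 < ε, ∫⁻ u : ℝ × ℝ × ℝ, ‖slice b F ε u‖ₑ ^ 2 with hCdef
  have hC : C < ⊤ := hF.2
  have hnorm : ∀ ε : ℝ, 0 < ε → ∀ᵐ x : ℝ,
      ∫⁻ v, ‖Complex.exp (freqForm v (tubePoint b x 0 0 ε)) * g v‖ₑ ^ 2 =
        ∫⁻ u : ℝ × ℝ, ‖slice b F ε (x, u)‖ₑ ^ 2 := fun ε hε => by
    filter_upwards [ae_memLp_fibre hb hF hε] with x hx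
    have h1 := hfour x (b x + ε) (by linarith) hx
    have h2 := lintegral_prod_eq_complex fun w => ‖fibre F x (b x + ε) w‖ₑ ^ 2
    refine Eq.trans ?_ h2.symm
    rw [← eLpNorm_two_sq, ← eLpNorm_two_sq]
    congr 1
    refine (eLpNorm_congr_ae h1).symm.trans ?_
    rw [← eLpNorm_congr_ae hx.coeFn_toLp, ← Lp.enorm_def, ← Lp.enorm_def, ← ofReal_norm,
      ← ofReal_norm, Lp.norm_fourier_eq]
  have hweight : ∀ ε : ℝ, 0 < ε → ∫⁻ v, ‖damp ε g v‖ₑ ^ 2 * weight b v ≤ C := fun ε hε => by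
    have hm : Measurable fun u => ‖slice b F ε u‖ₑ ^ 2 :=
      ((continuous_slice hb hF hε).measurable.enorm).pow_const 2
    have hm2 : Measurable (Function.uncurry fun (x : ℝ) (v : ℂ) =>
        ‖Complex.exp (freqForm v (tubePoint b x 0 0 ε)) * g v‖ₑ ^ 2) := by
      refine (Measurable.mul ?_ (hg.comp measurable_snd)).enorm.pow_const 2
      refine Continuous.measurable ?_
      exact (continuous_freqForm_uncurry.comp
        (continuous_snd.prodMk ((continuous_tubePoint_zero hb ε).comp continuous_fst))).cexp
    calc ∫⁻ v, ‖damp ε g v‖ₑ ^ 2 * weight b v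
        = ∫⁻ v, ∫⁻ x : ℝ, ‖Complex.exp (freqForm v (tubePoint b x 0 0 ε)) * g v‖ₑ ^ 2 := by
          refine lintegral_congr fun v => ?_
          simp only [exp_freqForm_tubePoint_mul b g v _ _ _ ε, enorm_mul, mul_pow]
          rw [lintegral_mul_const, mul_comm, weight]
          exact (((freqForm v).continuous.comp
            (continuous_tubePoint_zero hb 0)).cexp.measurable.enorm).pow_const 2
      _ = ∫⁻ x : ℝ, ∫⁻ v, ‖Complex.exp (freqForm v (tubePoint b x 0 0 ε)) * g v‖ₑ ^ 2 :=
          (lintegral_lintegral_swap hm2.aemeasurable).symm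
      _ = ∫⁻ x : ℝ, ∫⁻ u : ℝ × ℝ, ‖slice b F ε (x, u)‖ₑ ^ 2 := lintegral_congr_ae (hnorm ε hε)
      _ = ∫⁻ u, ‖slice b F ε u‖ₑ ^ 2 := by
          rw [Measure.volume_eq_prod ℝ (ℝ × ℝ), lintegral_prod _ hm.aemeasurable]
      _ ≤ C := le_iSup₂ (f := fun (ε : ℝ) (_ : 0 < ε) =>
          ∫⁻ u : ℝ × ℝ × ℝ, ‖slice b F ε u‖ₑ ^ 2) ε hε
  have hdm : ∀ ε, Measurable (damp ε g) := fun ε => by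
    unfold damp; fun_prop
  have hwm : ∀ ε, Measurable fun v => ‖damp ε g v‖ₑ ^ 2 * weight b v := fun ε =>
    ((hdm ε).enorm.pow_const 2).mul (measurable_weight hb)
  -- The weight is infinite for `τ < 0`, so there are no negative frequencies.
  have hzero : ∀ᵐ v : ℂ, 0 < v.im ∨ g v = 0 := by
    have him : ∀ᵐ v : ℂ, v.im ≠ 0 := by
      have h := Complex.volume_preserving_equiv_real_prod.quasiMeasurePreserving.ae
        (p := fun q : ℝ × ℝ => q.2 ≠ 0) ?_
      · exact h
      · rw [Measure.volume_eq_prod]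
        exact Measure.quasiMeasurePreserving_snd.ae (Measure.ae_ne volume (0:ℝ))
    filter_upwards [him, ae_lt_top (hwm 1) ((hweight 1 one_pos).trans_lt hC).ne] with v hv hv'
    rcases lt_or_gt_of_ne hv with h | h
    · right
      rw [hN v h] at hv'
      by_contra hne
      rw [ENNReal.mul_top] at hv'
      · exact lt_irrefl _ hv'
      · simp [damp, hne]
    · exact Or.inl h
  have hL2 : MemLp g 2 (weightMeasure b) := by
    refine memLp_two_iff.2 ⟨hg.aestronglyMeasurable, lt_of_le_of_lt ?_ hC⟩
    rw [lintegral_weightMeasure hb (hg.enorm.pow_const 2).aemeasurable]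
    refine (lintegral_mono' Measure.restrict_le_self le_rfl).trans ?_
    have hlim : ∀ v, liminf (fun n : ℕ => ‖damp (1 / ((n:ℝ) + 1)) g v‖ₑ ^ 2 * weight b v) atTop =
        ‖g v‖ₑ ^ 2 * weight b v := fun v => by
      refine Tendsto.liminf_eq ?_
      by_cases hw : g v = 0
      · simp [damp, hw]
      refine ENNReal.Tendsto.mul_const ?_ (Or.inl (by simp [hw]))
      have hc : Continuous fun ε : ℝ => ‖damp ε g v‖ₑ ^ 2 := by
        unfold damp; fun_prop
      have := (hc.tendsto 0).comp tendsto_one_div_add_atTop_nhds_zero_nat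
      simpa [Function.comp_def, damp] using this
    simp only [← hlim]
    refine (lintegral_liminf_le fun n => hwm _).trans ?_
    refine liminf_le_of_frequently_le' (Frequently.of_forall fun n => ?_)
    exact hweight _ Nat.one_div_pos_of_nat
  refine ⟨g, hL2, fun z hz => ?_⟩
  set ε := z.2.im - b z.1.re
  have hε : 0 < ε := sub_pos.2 hz
  have hcF := continuous_slice hb hF hε
  have hcE := continuous_slice hb (memHardy_laplace hb hL2) hε
  have hae : ∀ᵐ x : ℝ, ∀ y t : ℝ, slice b F ε (x, y, t) = slice b (laplace g) ε (x, y, t) := by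
    filter_upwards [ae_memLp_fibre hb hF hε] with x hx
    have hlt : b x < b x + ε := by linarith
    have h1 := hfour x (b x + ε) hlt hx
    set k := fun v => Complex.exp (freqForm v (axisPoint x (b x + ε))) * g v with hk
    have hk2 : MemLp k 2 := (Lp.memLp _).ae_eq h1
    have hind : k =ᵐ[volume] {v : ℂ | 0 < v.im}.indicator k := by
      filter_upwards [hzero] with v hv
      rcases hv with hv | hv
      · exact (Set.indicator_of_mem (show v ∈ {v : ℂ | 0 < v.im} from hv) k).symm
      · rw [Set.indicator_apply]; simp [hk, hv]
    have hk1 : Integrable k := by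
      refine Integrable.congr ?_ hind.symm
      refine (integrable_indicator_iff measurableSet_half).2 ?_
      exact integrable_exp_mul hb hL2 (z := axisPoint x (b x + ε)) hlt
    have h2 : 𝓕 (hx.toLp _) = hk2.toLp k := Lp.ext (h1.trans hk2.coeFn_toLp.symm)
    have h3 : hx.toLp _ = 𝓕⁻ (hk2.toLp k) := by
      rw [← h2, FourierTransform.fourierInv_fourier_eq]
    have h4 : fibre F x (b x + ε) =ᵐ[volume] 𝓕⁻ k := by
      refine hx.coeFn_toLp.symm.trans ?_
      rw [h3]
      exact coeFn_fourierInv_toLp hk1 hk2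
    have h5 : 𝓕⁻ k = fibre (laplace g) x (b x + ε) := by
      ext w
      have := laplace_tubePoint b g x w.re w.im ε
      refine Eq.trans ?_ this.symm
      rw [Real.fourierInv_eq_fourier_neg, Real.fourierInv_eq_fourier_neg]
      exact Real.fourier_congr_ae hind _
    rw [h5] at h4
    have h6 := (Continuous.ae_eq_iff_eq volume (continuous_fibre hF.1.continuousOn hlt)
      (continuous_fibre (differentiableOn_laplace hb hL2).continuousOn hlt)).1 h4
    exact fun y t => congrFun h6 ⟨y, t⟩
  have hfin : ∀ y t : ℝ, (fun x => slice b F ε (x, y, t)) =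
      fun x => slice b (laplace g) ε (x, y, t) := fun y t =>
    (Continuous.ae_eq_iff_eq (volume : Measure ℝ) (hcF.comp (by fun_prop))
      (hcE.comp (by fun_prop))).1 (hae.mono fun x hx => hx y t)
  have hz' : tubePoint b z.1.re z.1.im z.2.re ε = z := by
    simp [tubePoint, ε]
  have := congrFun (hfin z.1.im z.2.re) z.1.re
  simpa only [slice, hz'] using this

end

/-! ### The Szegő kernel -/

/-- The reciprocal of the weight, as a complex-valued function; it vanishes where the weight is
infinite. -/
def weightInv (b : ℝ → ℝ) (v : ℂ) : ℂ := ((weight b v)⁻¹.toReal : ℝ)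

/-- The function of the frequency whose Laplace integral is `w ↦ conj (S(z, w))`. -/
def kernelFun (b : ℝ → ℝ) (z : ℂ × ℂ) (v : ℂ) : ℂ :=
  starRingEnd ℂ (Complex.exp (freqForm v z)) * weightInv b v

/-- The Szegő kernel
`S(z, w) = ∫ exp (2π (η (z₁ + conj w₁) + i τ (z₂ - conj w₂))) / N(η, τ) dη dτ`. -/
def szegoKernel (b : ℝ → ℝ) (z w : ℂ × ℂ) : ℂ :=
  laplace (weightInv b) (z.1 + starRingEnd ℂ w.1, z.2 - starRingEnd ℂ w.2)

lemma conj_freqForm (v : ℂ) (w : ℂ × ℂ) :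
    starRingEnd ℂ (freqForm v w) = freqForm v (starRingEnd ℂ w.1, -starRingEnd ℂ w.2) := by
  simp [freqForm_apply, Complex.conj_ofNat]

lemma conj_szegoKernel (b : ℝ → ℝ) (z w : ℂ × ℂ) :
    starRingEnd ℂ (szegoKernel b z w) = laplace (kernelFun b z) w := by
  rw [szegoKernel, laplace, ← integral_conj]
  refine integral_congr_ae (ae_of_all _ fun v => ?_)
  have e : freqForm v (z.1 + starRingEnd ℂ w.1, z.2 - starRingEnd ℂ w.2) =
      freqForm v z + starRingEnd ℂ (freqForm v w) := by
    rw [conj_freqForm, ← map_add, Prod.add_def, sub_eq_add_neg]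
  simp only [e, kernelFun, weightInv, Complex.exp_add, map_mul, ← Complex.exp_conj,
    Complex.conj_conj, Complex.conj_ofReal]
  ring

section
variable {b : ℝ → ℝ} (hb : Continuous b)
include hb

lemma measurable_weightInv : Measurable (weightInv b) :=
  Complex.measurable_ofReal.comp (measurable_weight hb).inv.ennreal_toReal

lemma enorm_weightInv (v : ℂ) : ‖weightInv b v‖ₑ = (weight b v)⁻¹ := by
  rw [weightInv, ← ofReal_norm, Complex.norm_real, Real.norm_of_nonneg ENNReal.toReal_nonneg,
    ENNReal.ofReal_toReal (ENNReal.inv_ne_top.2 (weight_ne_zero hb v))]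

/-- The Laplace integral of the reciprocal of the weight converges at `2 z` wherever the
reproducing kernel converges at `z`. -/
lemma integrable_exp_mul_weightInv {ζ z : ℂ × ℂ} (h1 : ζ.1.re = 2 * z.1.re)
    (h2 : ζ.2.im = 2 * z.2.im)
    (hz : ∫⁻ v, ‖Complex.exp (freqForm v z)‖ₑ ^ 2 * (weight b v)⁻¹ ∂halfMeasure < ⊤) :
    Integrable (fun v => Complex.exp (freqForm v ζ) * weightInv b v) halfMeasure := by
  refine ⟨((continuous_freqForm_apply ζ).cexp.measurable.mul
    (measurable_weightInv hb)).aestronglyMeasurable, ?_⟩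
  refine lt_of_le_of_lt (lintegral_mono fun v => le_of_eq ?_) hz
  rw [enorm_mul, enorm_weightInv hb, ← enorm_pow]
  congr 1
  rw [← ofReal_norm, ← ofReal_norm, norm_pow, Complex.norm_exp, Complex.norm_exp, freqForm_re,
    freqForm_re, h1, h2, ← Real.exp_nat_mul]
  congr 2; push_cast; ring

lemma memLp_kernelFun {z : ℂ × ℂ} (hz : z ∈ tubeDomain b) :
    MemLp (kernelFun b z) 2 (weightMeasure b) := by
  have hm : Measurable (kernelFun b z) :=
    (Complex.continuous_conj.measurable.comp
      (continuous_freqForm_apply z).cexp.measurable).mul (measurable_weightInv hb)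
  refine memLp_two_iff.2 ⟨hm.aestronglyMeasurable, ?_⟩
  rw [lintegral_weightMeasure hb (hm.enorm.pow_const 2).aemeasurable]
  refine lt_of_le_of_lt (lintegral_mono fun v => ?_) (lintegral_enorm_sq_div_weight_lt_top hb hz)
  have e : ‖starRingEnd ℂ (Complex.exp (freqForm v z))‖ₑ = ‖Complex.exp (freqForm v z)‖ₑ := by
    rw [← ofReal_norm, ← ofReal_norm, RCLike.norm_conj]
  rw [kernelFun, enorm_mul, mul_pow, enorm_weightInv hb, e, mul_assoc, sq (weight b v)⁻¹,
    mul_assoc]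
  exact mul_le_mul_right (mul_le_of_le_one_right' (ENNReal.inv_mul_le_one _)) _

/-- The inner product with `kernelFun b z` in the weighted `L²` space is the value of
the Laplace integral at `z`. -/
lemma integral_conj_kernelFun (hfin : ∀ v : ℂ, 0 < v.im → weight b v ≠ ⊤) (z : ℂ × ℂ) (f : ℂ → ℂ) :
    ∫ v, starRingEnd ℂ (kernelFun b z v) * f v ∂weightMeasure b = laplace f z := by
  rw [weightMeasure, integral_withDensity_eq_integral_toReal_smul (measurable_weight hb)
    (ae_half.mono fun v hv => (hfin v hv).lt_top)]
  refine integral_congr_ae (ae_half.mono fun v hv => ?_)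
  have h : (weight b v).toReal * (weight b v)⁻¹.toReal = 1 := by
    rw [← ENNReal.toReal_mul, ENNReal.mul_inv_cancel (weight_ne_zero hb v) (hfin v hv),
      ENNReal.toReal_one]
  have h' : ((weight b v).toReal : ℂ) * ((weight b v)⁻¹.toReal : ℂ) = 1 := by
    rw [← Complex.ofReal_mul, h, Complex.ofReal_one]
  simp only [kernelFun, weightInv, map_mul, Complex.conj_conj, Complex.conj_ofReal,
    Complex.real_smul]
  linear_combination (Complex.exp (freqForm v z) * f v) * h'

omit hb in
lemma IsBoundaryValue.congr {F G : ℂ × ℂ → ℂ} {f : ℝ × ℝ × ℝ → ℂ}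
    (h : IsBoundaryValue b F f) (hFG : ∀ z ∈ tubeDomain b, G z = F z) : IsBoundaryValue b G f := by
  refine ⟨h.1, h.2.congr' ?_⟩
  filter_upwards [self_mem_nhdsWithin] with ε hε
  have : slice b G ε = slice b F ε := by
    ext u
    exact hFG _ (by simpa [tubeDomain, tubePoint] using hε)
  rw [this]

lemma IsBoundaryValue.ae_eq {F : ℂ × ℂ → ℂ} (hF : MemHardy b F) {f g : ℝ × ℝ × ℝ → ℂ}
    (hf : IsBoundaryValue b F f) (hg : IsBoundaryValue b F g) : f =ᵐ[volume] g := by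
  have h : Tendsto (fun ε : ℝ => eLpNorm (slice b F ε - f) 2 volume +
      eLpNorm (slice b F ε - g) 2 volume) (𝓝[>] 0) (𝓝 0) := by
    simpa using hf.2.add hg.2
  have hle : ∀ᶠ ε in 𝓝[>] (0:ℝ), eLpNorm (f - g) 2 volume ≤
      eLpNorm (slice b F ε - f) 2 volume + eLpNorm (slice b F ε - g) 2 volume := by
    filter_upwards [self_mem_nhdsWithin] with ε hε
    have hm := (continuous_slice hb hF hε).aestronglyMeasurable (μ := volume)
    have e : f - g = (slice b F ε - g) - (slice b F ε - f) := by abel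
    rw [e, add_comm]
    exact eLpNorm_sub_le (hm.sub hg.1.1) (hm.sub hf.1.1) (by norm_num)
  have h0 : eLpNorm (f - g) 2 volume = 0 := le_antisymm (ge_of_tendsto h hle) zero_le
  rw [eLpNorm_eq_zero_iff (hf.1.1.sub hg.1.1) (by norm_num)] at h0
  filter_upwards [h0] with u hu
  exact sub_eq_zero.1 hu

/-- The Laplace integral of the reciprocal of the weight gives the Szegő kernel. -/
theorem isSzegoKernel_szegoKernel (hN : ∀ v : ℂ, v.im < 0 → weight b v = ⊤)
    (hfin : ∀ v : ℂ, 0 < v.im → weight b v ≠ ⊤) : IsSzegoKernel b (szegoKernel b) := by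
  intro z hz
  have hk := memLp_kernelFun hb hz
  have e : (fun w => starRingEnd ℂ (szegoKernel b z w)) = laplace (kernelFun b z) := by
    ext w; rw [conj_szegoKernel]
  rw [e]
  refine ⟨memHardy_laplace hb hk, ?_⟩
  obtain ⟨κ, hκ⟩ := exists_isBoundaryValue_laplace hb hk
  refine ⟨κ, hκ, fun g hg => ?_⟩
  obtain ⟨f, hf, hgf⟩ := exists_eq_laplace hb hg hN
  obtain ⟨γ, hγ⟩ := exists_isBoundaryValue_laplace hb hf
  refine ⟨γ, hγ.congr hgf, ?_⟩
  rw [integral_conj_boundaryValue hb hk hf hκ hγ, integral_conj_kernelFun hb hfin, hgf z hz]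

/-- Two Szegő kernels are conjugate transposes of each other: apply the reproducing property of each
to the other one. -/
lemma IsSzegoKernel.conj_eq {S T : ℂ × ℂ → ℂ × ℂ → ℂ} (hS : IsSzegoKernel b S)
    (hT : IsSzegoKernel b T) {z w : ℂ × ℂ} (hz : z ∈ tubeDomain b) (hw : w ∈ tubeDomain b) :
    starRingEnd ℂ (S z w) = T w z := by
  obtain ⟨hSz, κ, hκ, hrS⟩ := hS z hz
  obtain ⟨hTw, θ, hθ, hrT⟩ := hT w hw
  obtain ⟨γ, hγ, e1⟩ := hrT _ hSz
  obtain ⟨γ', hγ', e2⟩ := hrS _ hTw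
  have h1 := hγ.ae_eq hb hSz hκ
  have h2 := hγ'.ae_eq hb hTw hθ
  rw [← Complex.conj_conj (T w z), e2, ← integral_conj, e1]
  refine integral_congr_ae ?_
  filter_upwards [h1, h2] with u hu hu'
  rw [hu, hu', map_mul, Complex.conj_conj, mul_comm]

/-- The Szegő kernel is unique. -/
theorem IsSzegoKernel.eq {S T : ℂ × ℂ → ℂ × ℂ → ℂ} (hS : IsSzegoKernel b S)
    (hT : IsSzegoKernel b T) {z w : ℂ × ℂ} (hz : z ∈ tubeDomain b) (hw : w ∈ tubeDomain b) :
    S z w = T z w := by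
  rw [← Complex.conj_conj (S z w), hS.conj_eq hb hS hz hw, hS.conj_eq hb hT hw hz]

end

/-! ### The weight of the quartic -/

lemma exists_quartic_bound {A : ℝ} (hA : 0 < A) (B D : ℝ) :
    ∃ C : ℝ, ∀ x : ℝ, -A * x ^ 4 + B * x ^ 2 + D * |x| ≤ C - x ^ 2 := by
  refine ⟨(B + 2) ^ 2 / (4 * A) + D ^ 2, fun x => ?_⟩
  have h1 : D * |x| ≤ D ^ 2 + x ^ 2 := by
    nlinarith [sq_nonneg (D - |x|), sq_abs x, sq_nonneg D, sq_nonneg x]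
  have h2 : -A * x ^ 4 + (B + 2) * x ^ 2 ≤ (B + 2) ^ 2 / (4 * A) := by
    rw [le_div_iff₀ (by positivity)]
    nlinarith [sq_nonneg (2 * A * x ^ 2 - (B + 2))]
  linarith

lemma lintegral_exp_quartic_lt_top {A : ℝ} (hA : 0 < A) (B D : ℝ) :
    ∫⁻ x : ℝ, ENNReal.ofReal (Real.exp (-A * x ^ 4 + B * x ^ 2 + D * |x|)) < ⊤ := by
  obtain ⟨C, hC⟩ := exists_quartic_bound hA B D
  have hi : Integrable fun x : ℝ => Real.exp C * Real.exp (-1 * x ^ 2) :=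
    (integrable_exp_neg_mul_sq one_pos).const_mul _
  refine lt_of_le_of_lt (lintegral_mono fun x => ?_) hi.lintegral_lt_top
  rw [← Real.exp_add]
  exact ENNReal.ofReal_le_ofReal (Real.exp_le_exp.2 ((hC x).trans (le_of_eq (by ring))))

lemma continuous_quartic (p q : ℝ) : Continuous (quartic p q) := by
  unfold quartic; fun_prop

lemma weight_quartic_ne_top (p q : ℝ) (v : ℂ) (hv : 0 < v.im) : weight (quartic p q) v ≠ ⊤ := by
  have hpi := Real.pi_pos
  rw [weight_eq]
  refine (lt_of_le_of_lt (lintegral_mono fun x => ?_)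
    (lintegral_exp_quartic_lt_top (A := Real.pi * v.im) (by positivity)
      (-(2 * Real.pi * v.im * p)) |4 * Real.pi * (v.re - v.im * q)|)).ne
  refine ENNReal.ofReal_le_ofReal (Real.exp_le_exp.2 ?_)
  have h := le_abs_self (4 * Real.pi * (v.re - v.im * q) * x)
  rw [abs_mul] at h
  simp only [quartic]
  linarith

lemma weight_quartic_eq_top (p q : ℝ) (v : ℂ) (hv : v.im < 0) : weight (quartic p q) v = ⊤ := by
  have hpi := Real.pi_pos
  obtain ⟨C, hC⟩ := exists_quartic_bound (A := Real.pi * -v.im) (by nlinarith)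
    (2 * Real.pi * v.im * p) |4 * Real.pi * (v.re - v.im * q)|
  rw [weight_eq, eq_top_iff]
  calc (⊤ : ENNReal) = ∫⁻ x in Set.Ioi (|C| + 1), 1 := by simp
    _ ≤ ∫⁻ x in Set.Ioi (|C| + 1), ENNReal.ofReal
          (Real.exp (4 * Real.pi * (v.re * x - v.im * quartic p q x))) := by
        refine setLIntegral_mono' measurableSet_Ioi fun x hx => ?_
        rw [ENNReal.one_le_ofReal, Real.one_le_exp_iff]
        have h1 := hC x
        have h2 := neg_abs_le (4 * Real.pi * (v.re - v.im * q) * x)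
        rw [abs_mul] at h2
        have hx' : |C| + 1 < x := hx
        have h3 : C ≤ x ^ 2 := by nlinarith [le_abs_self C, abs_nonneg C]
        simp only [quartic]
        linarith
    _ ≤ _ := setLIntegral_le_lintegral _ _

/-! ### The kernel inside the convex hull of the quartic tube domain -/

/-- The bitangent line `x ↦ q x - p²/4` touches the graph of the quartic at `±√(-p)`. -/
lemma quartic_sub_bitangent (p q x : ℝ) :
    quartic p q x - (q * x - p ^ 2 / 4) = (x ^ 2 + p) ^ 2 / 4 := by
  simp only [quartic]; ring

lemma quartic_of_abs_eq {p : ℝ} (hp : p < 0) (q : ℝ) {a : ℝ} (ha : |a| = Real.sqrt (-p)) :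
    quartic p q a = q * a - p ^ 2 / 4 := by
  have h2 : a ^ 2 = -p := by rw [← sq_abs, ha, Real.sq_sqrt (by linarith)]
  have := quartic_sub_bitangent p q a
  rw [h2] at this
  linarith

/-- The reproducing kernel converges at the points above the bitangent line and between the points of
tangency: they are convex combinations of points of the tube domain, and exponentials are convex. -/
lemma lintegral_quartic_lt_top {p : ℝ} (hp : p < 0) (q : ℝ) {z : ℂ × ℂ}
    (hz1 : |z.1.re| < Real.sqrt (-p)) (hz2 : q * z.1.re - p ^ 2 / 4 < z.2.im) :
    ∫⁻ v, ‖Complex.exp (freqForm v z)‖ₑ ^ 2 * (weight (quartic p q) v)⁻¹ ∂halfMeasure < ⊤ := by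
  have hb := continuous_quartic p q
  set a := Real.sqrt (-p)
  have ha0 : 0 ≤ a := Real.sqrt_nonneg _
  rw [abs_lt] at hz1
  -- The points of the parallel to the bitangent line through `z`.
  set P : ℝ → ℂ × ℂ := fun c => (⟨c, 0⟩, ⟨0, z.2.im + q * (c - z.1.re)⟩) with hPdef
  have hP : ∀ c : ℝ, |c| = a → P c ∈ tubeDomain (quartic p q) := fun c hc => by
    change quartic p q c < z.2.im + q * (c - z.1.re)
    rw [quartic_of_abs_eq hp q hc]
    linarith
  have h1 := lintegral_enorm_sq_div_weight_lt_top hb (hP a (abs_of_nonneg ha0))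
  have h2 := lintegral_enorm_sq_div_weight_lt_top hb (hP (-a) (by rw [abs_neg, abs_of_nonneg ha0]))
  refine lt_of_le_of_lt ?_ (ENNReal.add_lt_top.2 ⟨h1, h2⟩)
  rw [← lintegral_add_left]
  · refine lintegral_mono fun v => ?_
    rw [← add_mul]
    gcongr
    have key : ∀ c : ℝ, 0 ≤ (v.re - v.im * q) * (c - z.1.re) →
        ‖Complex.exp (freqForm v z)‖ₑ ^ 2 ≤ ‖Complex.exp (freqForm v (P c))‖ₑ ^ 2 := fun c hc => by
      rw [enorm_exp_freqForm_sq, enorm_exp_freqForm_sq]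
      refine ENNReal.ofReal_le_ofReal (Real.exp_le_exp.2 ?_)
      have := Real.pi_pos
      refine mul_le_mul_of_nonneg_left ?_ (by positivity)
      simp only [hPdef]
      linarith
    -- The sign of the slope decides which of the two points of tangency dominates.
    rcases le_total 0 (v.re - v.im * q) with h | h
    · exact (key a (mul_nonneg h (by linarith [hz1.2]))).trans le_self_add
    · exact (key (-a) (mul_nonneg_of_nonpos_of_nonpos h (by linarith [hz1.1]))).trans le_add_self
  · exact ((continuous_freqForm_apply _).cexp.measurable.enorm.pow_const 2).mul
      (measurable_weight hb).inv

/-- An open set on which the Laplace integral of the reciprocal of the weight converges: the part of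
the convex hull of the tube domain over `|Re z₁| < √(-p)`, dilated by the factor `2`. The dilation
occurs because the kernel is the Laplace integral at `(z₁ + conj w₁, z₂ - conj w₂)`, which has
the real part `2 Re z₁` and the imaginary part `2 Im z₂` when `w = z`. -/
def hullDomain (p q : ℝ) : Set (ℂ × ℂ) :=
  {ζ | |ζ.1.re| < 2 * Real.sqrt (-p) ∧ q * ζ.1.re - p ^ 2 / 2 < ζ.2.im}

lemma isOpen_hullDomain (p q : ℝ) : IsOpen (hullDomain p q) := by
  have h1 : IsOpen {ζ : ℂ × ℂ | |ζ.1.re| < 2 * Real.sqrt (-p)} :=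
    isOpen_lt (by fun_prop) (by fun_prop)
  have h2 : IsOpen {ζ : ℂ × ℂ | q * ζ.1.re - p ^ 2 / 2 < ζ.2.im} :=
    isOpen_lt (by fun_prop) (by fun_prop)
  exact h1.inter h2

lemma integrable_exp_mul_weightInv_quartic {p : ℝ} (hp : p < 0) (q : ℝ) {ζ : ℂ × ℂ}
    (hζ : ζ ∈ hullDomain p q) :
    Integrable (fun v => Complex.exp (freqForm v ζ) * weightInv (quartic p q) v) halfMeasure := by
  refine integrable_exp_mul_weightInv (continuous_quartic p q)
    (z := (⟨ζ.1.re / 2, 0⟩, ⟨0, ζ.2.im / 2⟩)) (by simp; ring) (by simp; ring)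
    (lintegral_quartic_lt_top hp q ?_ ?_)
  · have := hζ.1
    rw [abs_lt] at this ⊢
    constructor <;> linarith [this.1, this.2]
  · have := hζ.2
    change q * (ζ.1.re / 2) - p ^ 2 / 4 < ζ.2.im / 2
    linarith

theorem isNonsingularAt_szegoKernel {p : ℝ} (hp : p < 0) (q : ℝ) {z w : ℂ × ℂ}
    (h : (z.1 + starRingEnd ℂ w.1, z.2 - starRingEnd ℂ w.2) ∈ hullDomain p q) :
    IsNonsingularAt (tubeDomain (quartic p q)) (szegoKernel (quartic p q)) z w := by
  set φ : (ℂ × ℂ) × (ℂ × ℂ) → ℂ × ℂ := fun P =>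
    (P.1.1 + starRingEnd ℂ P.2.1, P.1.2 - starRingEnd ℂ P.2.2) with hφ
  have hconj : ContDiff ℝ ∞ (starRingEnd ℂ : ℂ → ℂ) := Complex.conjCLE.contDiff
  have hφs : ContDiff ℝ ∞ φ :=
    ((contDiff_fst.comp contDiff_fst).add (hconj.comp (contDiff_fst.comp contDiff_snd))).prodMk
      ((contDiff_snd.comp contDiff_fst).sub (hconj.comp (contDiff_snd.comp contDiff_snd)))
  refine ⟨φ ⁻¹' hullDomain p q, (isOpen_hullDomain p q).preimage hφs.continuous, h,
    fun P => laplace (weightInv (quartic p q)) (φ P), ?_, fun z _ w _ _ => rfl⟩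
  have hL := (contDiffOn_laplace (isOpen_hullDomain p q) fun ζ hζ =>
    integrable_exp_mul_weightInv_quartic hp q hζ).restrict_scalars ℝ
  exact hL.comp hφs.contDiffOn fun P hP => hP

/-! ### The singularity of the kernel -/

lemma volume_strip_ge (q : ℝ) {T : ℝ} :
    ENNReal.ofReal (2 * (T - 1)) ≤
      volume {v : ℂ | v.im ∈ Set.Icc 1 T ∧ v.re ∈ Set.Icc (v.im * q - 1) (v.im * q + 1)} := by
  set R' : Set (ℝ × ℝ) := {u | u.2 ∈ Set.Icc 1 T ∧ u.1 ∈ Set.Icc (u.2 * q - 1) (u.2 * q + 1)}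
  have hR' : MeasurableSet R' := by
    have h1 : MeasurableSet {u : ℝ × ℝ | u.2 ∈ Set.Icc 1 T} := measurable_snd measurableSet_Icc
    have h2 : MeasurableSet {u : ℝ × ℝ | u.2 * q - 1 ≤ u.1} :=
      measurableSet_le (by fun_prop) (by fun_prop)
    have h3 : MeasurableSet {u : ℝ × ℝ | u.1 ≤ u.2 * q + 1} :=
      measurableSet_le (by fun_prop) (by fun_prop)
    exact h1.inter (h2.inter h3)
  have e := Complex.volume_preserving_equiv_real_prod.measure_preimage hR'.nullMeasurableSet
  refine le_trans ?_ (le_of_eq e.symm)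
  rw [Measure.volume_eq_prod, Measure.prod_apply_symm hR']
  calc ENNReal.ofReal (2 * (T - 1)) = ∫⁻ τ in Set.Icc 1 T, ENNReal.ofReal 2 := by
        rw [setLIntegral_const, Real.volume_Icc, ENNReal.ofReal_mul (by norm_num)]
    _ ≤ ∫⁻ τ in Set.Icc 1 T, volume ((fun η => (η, τ)) ⁻¹' R') := by
        refine setLIntegral_mono' measurableSet_Icc fun τ hτ => ?_
        have : (fun η => (η, τ)) ⁻¹' R' = Set.Icc (τ * q - 1) (τ * q + 1) := by
          ext η
          simp only [R', Set.mem_preimage, Set.mem_ofPred_eq]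
          exact and_iff_right hτ
        rw [this, Real.volume_Icc]
        exact ENNReal.ofReal_le_ofReal (by linarith)
    _ ≤ _ := setLIntegral_le_lintegral _ _

/-- On a strip of frequencies around `η = q τ` the weight grows only like `exp (π p² τ)`. -/
lemma exists_weight_quartic_le (p q : ℝ) : ∃ K : ℝ, 0 < K ∧ ∀ v : ℂ, 1 ≤ v.im →
    v.re ∈ Set.Icc (v.im * q - 1) (v.im * q + 1) →
      weight (quartic p q) v ≤ ENNReal.ofReal (Real.exp (Real.pi * p ^ 2 * v.im) * K) := by
  have hpi := Real.pi_pos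
  set I := ∫⁻ x : ℝ, ENNReal.ofReal (Real.exp
    (-Real.pi * x ^ 4 + (-(2 * Real.pi * p)) * x ^ 2 + (4 * Real.pi) * |x|))
  have hI : I ≠ ⊤ := (lintegral_exp_quartic_lt_top hpi _ _).ne
  refine ⟨I.toReal + 1, by positivity, fun v hv hv' => ?_⟩
  rw [ENNReal.ofReal_mul (Real.exp_pos _).le, weight_eq]
  calc _ ≤ ∫⁻ x : ℝ, ENNReal.ofReal (Real.exp (Real.pi * p ^ 2 * v.im)) * ENNReal.ofReal (Real.exp
        (-Real.pi * x ^ 4 + (-(2 * Real.pi * p)) * x ^ 2 + (4 * Real.pi) * |x|)) := by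
        refine lintegral_mono fun x => ?_
        rw [← ENNReal.ofReal_mul (Real.exp_pos _).le, ← Real.exp_add]
        refine ENNReal.ofReal_le_ofReal (Real.exp_le_exp.2 ?_)
        have h1 : (v.re - v.im * q) * x ≤ |x| := by
          refine (le_abs_self _).trans ?_
          rw [abs_mul]
          refine mul_le_of_le_one_left (abs_nonneg x) (abs_le.2 ⟨?_, ?_⟩) <;>
            linarith [hv'.1, hv'.2]
        have h2 : Real.pi * (x ^ 2 + p) ^ 2 ≤ Real.pi * v.im * (x ^ 2 + p) ^ 2 := by
          gcongr
          exact le_mul_of_one_le_right hpi.le hv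
        have h3 := mul_le_mul_of_nonneg_left h1 (by positivity : 0 ≤ 4 * Real.pi)
        have h4 : 0 ≤ Real.pi * p ^ 2 := by positivity
        simp only [quartic]
        linarith
    _ = ENNReal.ofReal (Real.exp (Real.pi * p ^ 2 * v.im)) * I :=
        lintegral_const_mul' _ _ ENNReal.ofReal_ne_top
    _ ≤ _ := by
        gcongr
        rw [← ENNReal.ofReal_toReal hI]
        refine ENNReal.ofReal_le_ofReal ?_
        rw [ENNReal.toReal_ofReal ENNReal.toReal_nonneg]
        linarith

/-- A lower bound for the kernel at a pair of points above the two points of tangency. The bound is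
the contribution of the frequencies with `1 ≤ τ ≤ T` and `|η - q τ| ≤ 1`, a set of
measure `2 (T - 1)`. -/
lemma szegoKernel_re_ge {p : ℝ} (hp : p < 0) (q : ℝ) : ∃ K : ℝ, 0 < K ∧
    ∀ a y t h k T : ℝ, |a| = Real.sqrt (-p) → 0 < h → 0 < k → 1 ≤ T →
      2 * (T - 1) * (Real.exp (-(2 * Real.pi * T * (h + k))) * K) ≤
        (szegoKernel (quartic p q) (tubePoint (quartic p q) a y t h)
          (tubePoint (quartic p q) (-a) y t k)).re := by
  obtain ⟨K, hK, hKw⟩ := exists_weight_quartic_le p q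
  refine ⟨K⁻¹, inv_pos.2 hK, fun a y t h k T ha hh hk hT => ?_⟩
  have hpi := Real.pi_pos
  set b := quartic p q with hbdef
  have hb : Continuous b := continuous_quartic p q
  set ζ : ℂ × ℂ := (0, ⟨0, -p ^ 2 / 2 + (h + k)⟩) with hζ
  have hS : szegoKernel b (tubePoint b a y t h) (tubePoint b (-a) y t k) =
      laplace (weightInv b) ζ := by
    have e1 : b a = q * a - p ^ 2 / 4 := quartic_of_abs_eq hp q ha
    have e2 : b (-a) = q * (-a) - p ^ 2 / 4 := quartic_of_abs_eq hp q (by rwa [abs_neg])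
    rw [szegoKernel]
    congr 1
    refine Prod.ext (Complex.ext ?_ ?_) (Complex.ext ?_ ?_)
    · simp [tubePoint, hζ]
    · simp [tubePoint, hζ]
    · simp [tubePoint, hζ]
    · simp only [tubePoint, hζ, e1, e2, Complex.sub_im, Complex.conj_im]
      ring
  have hmem : ζ ∈ hullDomain p q := by
    refine ⟨?_, ?_⟩
    · have : 0 < Real.sqrt (-p) := Real.sqrt_pos.2 (by linarith)
      simpa [hζ] using this
    · simp only [hζ, Complex.zero_re]; linarith
  have hint := integrable_exp_mul_weightInv_quartic hp q hmem
  set φ : ℂ → ℝ := fun v => Real.exp (-(2 * Real.pi * v.im * (-p ^ 2 / 2 + (h + k)))) *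
    (weight b v)⁻¹.toReal with hφ
  have hφe : ∀ v, Complex.exp (freqForm v ζ) * weightInv b v = (φ v : ℂ) := fun v => by
    simp only [freqForm_apply, hζ, hφ, weightInv, Complex.mk_eq_add_mul_I]
    push_cast
    congr 2
    linear_combination (2 * Real.pi * v.im * (-p ^ 2 / 2 + (h + k)) : ℂ) * Complex.I_sq
  have hφi : Integrable φ halfMeasure := by
    refine hint.re.congr (ae_of_all _ fun v => ?_)
    change RCLike.re (Complex.exp (freqForm v ζ) * weightInv b v) = φ v
    rw [hφe]; simp
  have hre : (laplace (weightInv b) ζ).re = ∫ v, φ v ∂halfMeasure := by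
    rw [laplace, integral_congr_ae (ae_of_all _ hφe), integral_complex_ofReal, Complex.ofReal_re]
  rw [hS, hre]
  set R := {v : ℂ | v.im ∈ Set.Icc 1 T ∧ v.re ∈ Set.Icc (v.im * q - 1) (v.im * q + 1)} with hR
  have hRm : MeasurableSet R := by
    have h1 : MeasurableSet {v : ℂ | v.im ∈ Set.Icc 1 T} := Complex.measurable_im measurableSet_Icc
    have h2 : MeasurableSet {v : ℂ | v.im * q - 1 ≤ v.re} :=
      measurableSet_le (by fun_prop) (by fun_prop)
    have h3 : MeasurableSet {v : ℂ | v.re ≤ v.im * q + 1} :=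
      measurableSet_le (by fun_prop) (by fun_prop)
    exact h1.inter (h2.inter h3)
  have hlow : ∀ v ∈ R, Real.exp (-(2 * Real.pi * T * (h + k))) * K⁻¹ ≤ φ v := fun v hv => by
    have hv0 : 0 < v.im := by linarith [hv.1.1]
    have hw := hKw v hv.1.1 hv.2
    have hE := Real.exp_pos (Real.pi * p ^ 2 * v.im)
    have hw' : (Real.exp (Real.pi * p ^ 2 * v.im) * K)⁻¹ ≤ (weight b v)⁻¹.toReal := by
      rw [ENNReal.toReal_inv]
      refine inv_anti₀ (ENNReal.toReal_pos (weight_ne_zero hb v)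
        (weight_quartic_ne_top p q v hv0)) ?_
      exact ENNReal.toReal_le_of_le_ofReal (by positivity) hw
    calc Real.exp (-(2 * Real.pi * T * (h + k))) * K⁻¹
        ≤ Real.exp (-(2 * Real.pi * v.im * (h + k))) * K⁻¹ := by
          gcongr; exact hv.1.2
      _ = Real.exp (-(2 * Real.pi * v.im * (-p ^ 2 / 2 + (h + k)))) *
            (Real.exp (Real.pi * p ^ 2 * v.im) * K)⁻¹ := by
          rw [mul_inv, ← mul_assoc, ← Real.exp_neg, ← Real.exp_add]
          congr 2; ring
      _ ≤ φ v := mul_le_mul_of_nonneg_left hw' (Real.exp_pos _).le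
  have hφ0 : ∀ v, 0 ≤ φ v := fun v => mul_nonneg (Real.exp_pos _).le ENNReal.toReal_nonneg
  have hvol : ENNReal.ofReal (2 * (T - 1)) ≤ halfMeasure R := by
    have : R ∩ {v : ℂ | 0 < v.im} = R := Set.inter_eq_left.2 fun v hv => by
      have := hv.1.1
      simp only [Set.mem_ofPred_eq]; linarith
    rw [halfMeasure, Measure.restrict_apply hRm, this]
    exact volume_strip_ge q
  rw [← ENNReal.ofReal_le_ofReal_iff (integral_nonneg hφ0),
    ofReal_integral_eq_lintegral_ofReal hφi (ae_of_all _ hφ0),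
    ENNReal.ofReal_mul (by linarith), mul_comm]
  calc _ ≤ ENNReal.ofReal (Real.exp (-(2 * Real.pi * T * (h + k))) * K⁻¹) * halfMeasure R := by
        gcongr
    _ = ∫⁻ v in R, ENNReal.ofReal (Real.exp (-(2 * Real.pi * T * (h + k))) * K⁻¹) ∂halfMeasure :=
        (setLIntegral_const _ _).symm
    _ ≤ ∫⁻ v in R, ENNReal.ofReal (φ v) ∂halfMeasure :=
        setLIntegral_mono' hRm fun v hv => ENNReal.ofReal_le_ofReal (hlow v hv)
    _ ≤ _ := setLIntegral_le_lintegral _ _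

theorem tendsto_szegoKernel_re {p : ℝ} (hp : p < 0) (q : ℝ) {a : ℝ} (y t : ℝ)
    (ha : |a| = Real.sqrt (-p)) :
    Tendsto (fun d : ℝ × ℝ => (szegoKernel (quartic p q) (tubePoint (quartic p q) a y t d.1)
      (tubePoint (quartic p q) (-a) y t d.2)).re)
      (𝓝[Set.Ioi 0 ×ˢ Set.Ioi 0] (0, 0)) atTop := by
  obtain ⟨K, hK, hle⟩ := szegoKernel_re_ge hp q
  refine tendsto_atTop.2 fun M => ?_
  set E := Real.exp (-(2 * Real.pi)) * K
  have hE : 0 < E := by positivity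
  -- With this `T` the lower bound exceeds `M` as soon as `T (h + k) ≤ 1`.
  set T := 1 + |M| / (2 * E) with hT
  have hT1 : 1 ≤ T := by rw [hT]; linarith [div_nonneg (abs_nonneg M) (by positivity : 0 ≤ 2 * E)]
  have hnear : ∀ᶠ d : ℝ × ℝ in 𝓝[Set.Ioi 0 ×ˢ Set.Ioi 0] (0, 0), d.1 + d.2 < 1 / T := by
    refine nhdsWithin_le_nhds ?_
    have hc : Continuous fun d : ℝ × ℝ => d.1 + d.2 := by fun_prop
    refine (hc.tendsto (0, 0)).eventually_lt_const ?_
    simp only [add_zero]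
    positivity
  filter_upwards [hnear, self_mem_nhdsWithin] with d hd hd0
  refine le_trans ?_ (hle a y t d.1 d.2 T ha hd0.1 hd0.2 hT1)
  have hTd : T * (d.1 + d.2) ≤ 1 := by
    rw [lt_div_iff₀ (by linarith)] at hd
    linarith
  calc M ≤ |M| := le_abs_self M
    _ = 2 * (T - 1) * E := by rw [hT]; field_simp; ring
    _ ≤ _ := by
        have : 0 ≤ 2 * (T - 1) := by linarith
        refine mul_le_mul_of_nonneg_left (mul_le_mul_of_nonneg_right ?_ hK.le) this
        apply Real.exp_le_exp.2
        nlinarith [Real.pi_pos]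

/-- A kernel which tends to infinity at a pair of boundary points is singular there. -/
lemma not_isNonsingularAt_of_tendsto {b : ℝ → ℝ} {S : ℂ × ℂ → ℂ × ℂ → ℂ} {x x' y t : ℝ}
    (h : Tendsto (fun d : ℝ × ℝ => (S (tubePoint b x y t d.1) (tubePoint b x' y t d.2)).re)
      (𝓝[Set.Ioi 0 ×ˢ Set.Ioi 0] (0, 0)) atTop) :
    ¬ IsNonsingularAt (tubeDomain b) S (tubePoint b x y t 0) (tubePoint b x' y t 0) := by
  rintro ⟨U, hU, hmem, G, hG, hGS⟩
  set P : ℝ × ℝ → (ℂ × ℂ) × (ℂ × ℂ) := fun d => (tubePoint b x y t d.1, tubePoint b x' y t d.2)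
  have hP : Continuous P := by
    simp only [P, tubePoint, Complex.mk_eq_add_mul_I]
    fun_prop
  have hPt : Tendsto P (𝓝[Set.Ioi 0 ×ˢ Set.Ioi 0] (0, 0)) (𝓝 (P (0, 0))) :=
    (hP.tendsto (0, 0)).mono_left nhdsWithin_le_nhds
  have hGt : Tendsto (fun d => (G (P d)).re) (𝓝[Set.Ioi 0 ×ˢ Set.Ioi 0] (0, 0))
      (𝓝 (G (P (0, 0))).re) :=
    (Complex.continuous_re.tendsto _).comp
      (((hG.continuousOn.continuousAt (hU.mem_nhds hmem)).tendsto).comp hPt)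
  have : NeBot (𝓝[Set.Ioi (0:ℝ) ×ˢ Set.Ioi (0:ℝ)] ((0:ℝ), (0:ℝ))) := by
    rw [nhdsWithin_prod_eq]; infer_instance
  refine not_tendsto_nhds_of_tendsto_atTop h _ (hGt.congr' ?_)
  filter_upwards [hPt.eventually_mem (hU.mem_nhds hmem), self_mem_nhdsWithin] with d hd hd0
  have h1 : 0 < d.1 := hd0.1
  have h2 : 0 < d.2 := hd0.2
  exact congrArg Complex.re (hGS _ (by simpa [tubeDomain, tubePoint] using h1) _
    (by simpa [tubeDomain, tubePoint] using h2) hd)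

/-! ### The boundary of the tube domain -/

lemma im_eq_of_mem_frontier {b : ℝ → ℝ} (hb : Continuous b) {z : ℂ × ℂ}
    (hz : z ∈ frontier (tubeDomain b)) : z.2.im = b z.1.re :=
  (frontier_lt_subset_eq (f := fun z : ℂ × ℂ => b z.1.re) (g := fun z => z.2.im)
    (by fun_prop) (by fun_prop) hz).symm

lemma tubePoint_mem_frontier {b : ℝ → ℝ} (hb : Continuous b) (x y t : ℝ) :
    tubePoint b x y t 0 ∈ frontier (tubeDomain b) := by
  rw [(isOpen_tubeDomain hb).frontier_eq]
  refine ⟨?_, by simp [tubeDomain, tubePoint]⟩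
  have hc : Continuous fun h : ℝ => tubePoint b x y t h := by
    simp only [tubePoint, Complex.mk_eq_add_mul_I]
    fun_prop
  refine mem_closure_of_tendsto ((hc.tendsto 0).mono_left (nhdsWithin_le_nhds (s := Set.Ioi 0))) ?_
  filter_upwards [self_mem_nhdsWithin] with h hh
  simpa [tubeDomain, tubePoint] using hh

/-- The tube domain of the quartic is not pseudoconvex, because the quartic is concave at `0`. -/
theorem not_isPseudoconvex_quartic {p : ℝ} (hp : p < 0) (q : ℝ) :
    ¬ IsPseudoconvex (tubeDomain (quartic p q)) := by
  intro hps
  let ρ : ℂ × ℂ → ℝ := fun z => quartic p q z.1.re - z.2.im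
  let re₁ : ℂ × ℂ →L[ℝ] ℝ := Complex.reCLM.comp (ContinuousLinearMap.fst ℝ ℂ ℂ)
  let im₂ : ℂ × ℂ →L[ℝ] ℝ := Complex.imCLM.comp (ContinuousLinearMap.snd ℝ ℂ ℂ)
  have hd1 : ∀ z : ℂ × ℂ, HasFDerivAt ρ ((z.1.re ^ 3 + p * z.1.re + q) • re₁ - im₂) z := fun z => by
    have h1 : HasDerivAt (quartic p q) (z.1.re ^ 3 + p * z.1.re + q) z.1.re := by
      have := (((hasDerivAt_pow 4 z.1.re).div_const 4).add
        (((hasDerivAt_pow 2 z.1.re).const_mul p).div_const 2)).add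
          ((hasDerivAt_id z.1.re).const_mul q)
      refine this.congr_deriv ?_
      norm_num; ring
    exact (h1.comp_hasFDerivAt z re₁.hasFDerivAt).sub im₂.hasFDerivAt
  have hfd : fderiv ℝ ρ = fun z => (z.1.re ^ 3 + p * z.1.re + q) • re₁ - im₂ := by
    ext1 z; exact (hd1 z).fderiv
  have hd2 : HasFDerivAt (fderiv ℝ ρ) ((p • re₁).smulRight re₁) (0 : ℂ × ℂ) := by
    rw [hfd]
    have h1 : HasDerivAt (fun x : ℝ => x ^ 3 + p * x + q) p (re₁ 0) := by
      have := ((hasDerivAt_pow 3 (re₁ 0)).add ((hasDerivAt_id (re₁ 0)).const_mul p)).add_const q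
      refine this.congr_deriv ?_
      simp
    have h2 := (h1.comp_hasFDerivAt (0 : ℂ × ℂ) re₁.hasFDerivAt)
    exact (h2.smul_const re₁).sub_const im₂
  have hdef : IsLocalDefiningFunction (tubeDomain (quartic p q)) 0 ρ := by
    refine ⟨Set.univ, isOpen_univ, Set.mem_univ _, ?_, ?_, ?_⟩
    · apply ContDiff.contDiffOn
      have hq : ContDiff ℝ 2 (quartic p q) := by unfold quartic; fun_prop
      exact (hq.comp re₁.contDiff).sub im₂.contDiff
    · ext z
      simp [tubeDomain, ρ]
    · rw [(hd1 0).fderiv]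
      intro h
      have := congrArg (fun L => L ((0 : ℂ), Complex.I)) h
      simp [re₁, im₂] at this
  have hfr : (0 : ℂ × ℂ) ∈ frontier (tubeDomain (quartic p q)) := by
    have := tubePoint_mem_frontier (continuous_quartic p q) 0 0 0
    have e : tubePoint (quartic p q) 0 0 0 0 = 0 := by
      simp [tubePoint, quartic]; rfl
    rwa [e] at this
  have := hps 0 hfr ρ hdef (1, q * Complex.I) (by rw [(hd1 0).fderiv]; simp [re₁, im₂])
    (by rw [(hd1 0).fderiv]; simp [re₁, im₂])
  rw [leviForm, hd2.fderiv] at this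
  simp [re₁] at this
  linarith

end

theorem mainTheorem3 (p q : ℝ) (hp : p < 0) :
    ¬ IsPseudoconvex (tubeDomain (quartic p q)) ∧
    ∃ S : ℂ × ℂ → ℂ × ℂ → ℂ,
      IsSzegoKernel (quartic p q) S ∧
      (∀ S' : ℂ × ℂ → ℂ × ℂ → ℂ, IsSzegoKernel (quartic p q) S' →
        ∀ z ∈ tubeDomain (quartic p q), ∀ w ∈ tubeDomain (quartic p q), S' z w = S z w) ∧
      (∀ z ∈ frontier (tubeDomain (quartic p q)), |z.1.re| < Real.sqrt (-p) →
        IsNonsingularAt (tubeDomain (quartic p q)) S z z) ∧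
      (∀ a y t : ℝ, |a| = Real.sqrt (-p) →
        tubePoint (quartic p q) a y t 0 ∈ frontier (tubeDomain (quartic p q)) ∧
        tubePoint (quartic p q) (-a) y t 0 ∈ frontier (tubeDomain (quartic p q)) ∧
        tubePoint (quartic p q) a y t 0 ≠ tubePoint (quartic p q) (-a) y t 0 ∧
        ¬ IsNonsingularAt (tubeDomain (quartic p q)) S
          (tubePoint (quartic p q) a y t 0) (tubePoint (quartic p q) (-a) y t 0) ∧
        Filter.Tendsto
          (fun d : ℝ × ℝ =>
            (S (tubePoint (quartic p q) a y t d.1) (tubePoint (quartic p q) (-a) y t d.2)).re)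
          (nhdsWithin (0, 0) (Set.Ioi 0 ×ˢ Set.Ioi 0)) Filter.atTop) := by
  have hb := continuous_quartic p q
  have hS := isSzegoKernel_szegoKernel hb (weight_quartic_eq_top p q) (weight_quartic_ne_top p q)
  refine ⟨not_isPseudoconvex_quartic hp q, szegoKernel (quartic p q), hS,
    fun S' hS' z hz w hw => hS'.eq hb hS hz hw, fun z hz hz1 => ?_, fun a y t ha => ?_⟩
  · refine isNonsingularAt_szegoKernel hp q ⟨?_, ?_⟩
    · simp only [Complex.add_re, Complex.conj_re]
      rw [← two_mul, abs_mul, abs_two]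
      linarith
    · -- Strictly between the points of tangency the graph lies above the bitangent line.
      have h1 := quartic_sub_bitangent p q z.1.re
      have h2 : z.1.re ^ 2 < -p := by
        rw [← sq_abs, ← Real.sq_sqrt (by linarith : 0 ≤ -p)]
        exact pow_lt_pow_left₀ hz1 (abs_nonneg _) two_ne_zero
      have h3 : 0 < (z.1.re ^ 2 + p) ^ 2 / 4 := by
        have : z.1.re ^ 2 + p < 0 := by linarith
        have := mul_pos_of_neg_of_neg this this
        nlinarith
      simp only [Complex.add_re, Complex.conj_re, Complex.sub_im, Complex.conj_im,
        im_eq_of_mem_frontier hb hz]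
      linarith
  · have ht := tendsto_szegoKernel_re hp q y t ha
    refine ⟨tubePoint_mem_frontier hb a y t, tubePoint_mem_frontier hb (-a) y t, fun h => ?_,
      not_isNonsingularAt_of_tendsto ht, ht⟩
    have h1 : a = -a := congrArg (fun z : ℂ × ℂ => z.1.re) h
    have h2 : a = 0 := by linarith
    rw [h2, abs_zero] at ha
    exact absurd ha.symm (Real.sqrt_pos.2 (by linarith)).ne'
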